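/- Let $n\ge 2$ and $[n]=\{1,\dots,n\}$, and let $a_i^\dagger,a_i$ $(i\in[n])$ be the fermionic creation and annihilation operators on the $2^n$-dimensional Fock space $\mathcal H$ with vacuum $|0\rangle$, so that $\{a_i^\dagger,a_j\}=\delta_{ij}\mathbb 1$ and $\{a_i^\dagger,a_j^\dagger\}=0$. Let $\gamma\in\mathbb C$ with $\operatorname{Im}\gamma\ne 0$ and $|\gamma|\neq 1$, and let $M$ be the Hermitian $n\times n$ matrix $$M_{ij}=\begin{cases}1, & i=j,\\ -\,i\,\operatorname{Im}\gamma\,(\gamma^*)^{\,j-i-1}, & i<j,\\ i\,\operatorname{Im}\gamma\;\gamma^{\,i-j-1}, & i>j\end{cases}$$ (in the prefactors $i$ is the imaginary unit), which is a reduced metric of the chain $\gamma a_1^\dagger a_1+\gamma^* a_n^\dagger a_n+\sum_{i=1}^{n-1}(a_i^\dagger a_{i+1}+a_{i+1}^\dagger a_i)$. Assume that $M$ is positive definite, and let $\eta$ be the total metric, that is, the unique operator on $\mathcal H$ with $\eta a_i^\dagger=\sum_j M_{ji}a_j^\dagger\eta$ for all $i$ and $\eta|0\rangle=|0\rangle$.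 An operator $O$ is quasi-Hermitian if $\eta O=O^\dagger\eta$. For $S\subseteq[n]$, an operator is Bravyi–Kitaev local to $S$ if it is in the linear span of the products $\big(\prod_{i\in S_1}a_i^\dagger\big)\big(\prod_{j\in S_2}a_j\big)$ with $S_1,S_2\subseteq S$ and $|S_1|+|S_2|$ even; it is extensively local over $S$ if it is local to $S$ but not to any proper subset of $S$. For $A\subseteq[n]$ let $G_A$ be the graph with vertex set $A$ and edges $\{i,i+1\}$ for $i,i+1\in A$. By a component of $A$ we mean the vertex set of a connected component of $G_A$; the distance of two components is the minimum of $|i-j|$ over $i$ in the first and $j$ in the second. The leftmost component $C_L$ is the one that contains $\min A$, the rightmost component $C_R$ the one that contains $\max A$, and these are the edge components. Then for every $A\subseteq[n]$ there is a quasi-Hermitian operator that is extensively local over $A$ if and only if all of the following conditions hold (for $A=\emptyset$ they hold vacuously): 1. If $C$ is a component of $A$ with $|C|\le 2$ and $C\notin\{\{1,2\},\{n-1,n\}\}$, then $A$ has at least one other component. 2. If $\{i\}$ is a component of $A$, then each of $i-2$, $i+2$ that lies in $[n]$ lies in $A$. 3. If $C$ is a component of $A$ with $|C|=2$ and $C\notin\{\{1,2\},\{n-1,n\}\}$,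 then some other component of $A$ is at distance at most $2$ from $C$. 4. An edge component of $A$ has a single site only if it is $C_L=\{1\}$ or $C_R=\{n\}$. -/

import Mathlib

open Matrix
open scoped ComplexOrder

/-- Operators on the `2ⁿ`-dimensional fermionic Hilbert space over the sites `[n] = {1, …, n}`, as
matrices in the orthonormal occupation number basis, which is labelled by the subsets of the set of
sites. The element `i : Fin n` stands for the site with label `i + 1`. -/
abbrev FockOp (n : ℕ) := Matrix (Finset (Fin n)) (Finset (Fin n)) ℂ

/-- The vacuum, as a vector in the occupation number basis. -/
def vacuum (n : ℕ) : Finset (Fin n) → ℂ := Pi.single ∅ 1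

/-- The creation operator `a†ᵢ`: it sends the basis state `T` to `± (T ∪ {i})` if `i ∉ T`, and to
`0` if `i ∈ T`; the sign is `-1` to the number of occupied sites to the left of `i`. -/
def creation {n : ℕ} (i : Fin n) : FockOp n :=
  Matrix.of fun S T => if i ∉ T ∧ S = insert i T then (-1) ^ (T.filter (· < i)).card else 0

/-- The annihilation operator `aᵢ`, the adjoint of `a†ᵢ`. -/
def annihilation {n : ℕ} (i : Fin n) : FockOp n := (creation i)ᴴ

/-- `a†(g) = ∑ᵢ gᵢ a†ᵢ`. -/
def creationVec {n : ℕ} (g : Fin n → ℂ) : FockOp n := ∑ i, g i • creation i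

/-- The product of the `a†ᵢ`, `i ∈ S`, in increasing order of the sites. -/
def creationProd {n : ℕ} (S : Finset (Fin n)) : FockOp n :=
  (S.sort.map creation).prod

/-- The product of the `aᵢ`, `i ∈ S`, in increasing order of the sites. -/
def annihilationProd {n : ℕ} (S : Finset (Fin n)) : FockOp n :=
  (S.sort.map annihilation).prod

/-- The space of operators that are Bravyi–Kitaev local to `S`. -/
def bkLocal {n : ℕ} (S : Finset (Fin n)) : Submodule ℂ (FockOp n) :=
  Submodule.span ℂ {X | ∃ A B : Finset (Fin n), A ⊆ S ∧ B ⊆ S ∧ Even (A.card + B.card) ∧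
    X = creationProd A * annihilationProd B}

/-- `O` is Bravyi–Kitaev extensively local over `S`: local to `S`, and to no proper subset. -/
def IsBKExtensivelyLocal {n : ℕ} (S : Finset (Fin n)) (O : FockOp n) : Prop :=
  O ∈ bkLocal S ∧ ∀ S₁ : Finset (Fin n), S₁ ⊂ S → O ∉ bkLocal S₁

/-- The defining equations of the total metric that belongs to a reduced metric `M`:
`η a†ᵢ = ∑ⱼ Mⱼᵢ a†ⱼ η` and `η |0⟩ = |0⟩`. -/
def IsTotalMetric {n : ℕ} (M : Matrix (Fin n) (Fin n) ℂ) (η : FockOp n) : Prop :=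
  (∀ i, η * creation i = ∑ j, M j i • (creation j * η)) ∧ η *ᵥ vacuum n = vacuum n

/-- The total metric of a reduced metric `M`, given by its columns:
`η |T⟩ = (∏_{i ∈ T} a†(M eᵢ)) |0⟩`. It is the unique solution of the defining equations, see
`isTotalMetric_iff`. -/
def totalMetric {n : ℕ} (M : Matrix (Fin n) (Fin n) ℂ) : FockOp n :=
  Matrix.of fun S T =>
    ((T.sort.map fun i => creationVec fun j => M j i).prod *ᵥ vacuum n) S

/-- `O` is quasi-Hermitian with respect to `η`. -/
def IsQuasiHermitian {n : ℕ} (η O : FockOp n) : Prop := η * O = Oᴴ * η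

/-- The reduced metric of the model with non-Hermitian impurities `γ`, `γ*` at the two ends of the
chain and unit hopping amplitudes. -/
noncomputable def farMetric (n : ℕ) (γ : ℂ) : Matrix (Fin n) (Fin n) ℂ :=
  Matrix.of fun i j =>
    if i = j then 1
    else if i < j then -Complex.I * (γ.im : ℂ) * (starRingEnd ℂ γ) ^ (j.val - i.val - 1)
    else Complex.I * (γ.im : ℂ) * γ ^ (i.val - j.val - 1)

/-- The graph `G_A`: vertices `A`, edges between consecutive sites. -/
def siteGraph {n : ℕ} (A : Finset (Fin n)) : SimpleGraph (A : Set (Fin n)) :=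
  (SimpleGraph.pathGraph n).induce (A : Set (Fin n))

/-- `C` is (the set of sites of) a connected component of `G_A`. -/
def IsComponent {n : ℕ} (A C : Finset (Fin n)) : Prop :=
  ∃ c : (siteGraph A).ConnectedComponent, (C : Set (Fin n)) = Subtype.val '' c.supp

/-- The distance of two sets of sites, `min {d(i, j) : i ∈ C₁, j ∈ C₂}` with the geodesic distance
of the path (components are never empty). -/
noncomputable def siteDist {n : ℕ} (C₁ C₂ : Finset (Fin n)) : ℕ :=
  sInf {d | ∃ i ∈ C₁, ∃ j ∈ C₂, d = (SimpleGraph.pathGraph n).dist i j}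

/-- The labels in `{1, …, n}` of a set of sites. -/
def labels {n : ℕ} (C : Finset (Fin n)) : Finset ℕ := C.image fun i => i.val + 1

/-- `C` is `{1, 2}` or `{n - 1, n}`. -/
def IsEndPair {n : ℕ} (C : Finset (Fin n)) : Prop :=
  labels C = {1, 2} ∨ labels C = {n - 1, n}

/-- `C` is the leftmost component of `G_A`, the one that contains `min A`. -/
def IsLeftmost {n : ℕ} (A C : Finset (Fin n)) : Prop :=
  IsComponent A C ∧ ∃ i ∈ C, ∀ j ∈ A, i ≤ j

/-- `C` is the rightmost component of `G_A`, the one that contains `max A`. -/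
def IsRightmost {n : ℕ} (A C : Finset (Fin n)) : Prop :=
  IsComponent A C ∧ ∃ i ∈ C, ∀ j ∈ A, j ≤ i

/-- The four conditions on the connected components of `G_A`. -/
structure ConnectivityConditions {n : ℕ} (A : Finset (Fin n)) : Prop where
  /-- A component with at most two sites, other than `{1, 2}` and `{n - 1, n}`, is not the only
  component. -/
  not_alone : ∀ C, IsComponent A C → C.card ≤ 2 → ¬ IsEndPair C →
    ∃ C', IsComponent A C' ∧ C' ≠ C
  /-- If `{i}` is a component, then `i - 2` and `i + 2` are in `A` as far as they are in `[n]`. -/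
  single : ∀ i, IsComponent A {i} →
    ∀ j : Fin n, (j.val + 2 = i.val ∨ j.val = i.val + 2) → j ∈ A
  /-- A component with two sites, other than `{1, 2}` and `{n - 1, n}`, is at distance at most `2`
  from another component. -/
  pair : ∀ C, IsComponent A C → C.card = 2 → ¬ IsEndPair C →
    ∃ C', IsComponent A C' ∧ C' ≠ C ∧ siteDist C C' ≤ 2
  /-- An edge component has a single site only if it is `C_L = {1}` or `C_R = {n}`. -/
  edge : ∀ C, (IsLeftmost A C ∨ IsRightmost A C) → C.card = 1 →
    (IsLeftmost A C ∧ labels C = {1}) ∨ (IsRightmost A C ∧ labels C = {n})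

section facts

variable {n : ℕ}

theorem creation_mulVec_single (i : Fin n) (T : Finset (Fin n)) :
    creation i *ᵥ Pi.single T 1 =
      if i ∈ T then 0 else (-1 : ℂ) ^ (T.filter (· < i)).card • Pi.single (insert i T) 1 := by
  ext S
  by_cases h : i ∈ T
  · simp [creation, h]
  · simp [creation, h, Pi.single_apply]

theorem annihilation_mulVec_single (i : Fin n) (T : Finset (Fin n)) :
    annihilation i *ᵥ Pi.single T 1 =
      if i ∈ T then (-1 : ℂ) ^ (T.filter (· < i)).card • Pi.single (T.erase i) 1 else 0 := by
  ext S
  by_cases h : i ∈ T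
  · by_cases hS : S = T.erase i
    · subst hS
      have : ((T.erase i).filter (· < i)) = T.filter (· < i) := by
        ext k; simp only [Finset.mem_filter, Finset.mem_erase]
        constructor
        · rintro ⟨⟨-, h2⟩, h3⟩; exact ⟨h2, h3⟩
        · rintro ⟨h2, h3⟩; exact ⟨⟨h3.ne, h2⟩, h3⟩
      simp [annihilation, creation, h, this]
    · have : ¬ (i ∉ S ∧ T = insert i S) := by
        rintro ⟨h1, rfl⟩
        exact hS (by simp [h1])
      simp [annihilation, creation, h, this, hS]
  · have : ¬ (i ∉ S ∧ T = insert i S) := by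
      rintro ⟨h1, rfl⟩
      exact h (by simp)
    simp [annihilation, creation, h, this]

theorem card_filter_insert_lt {i j : Fin n} {T : Finset (Fin n)} (hj : j ∉ T) :
    ((insert j T).filter (· < i)).card = (T.filter (· < i)).card + if j < i then 1 else 0 := by
  rw [Finset.filter_insert]
  split_ifs with h
  · rw [Finset.card_insert_of_notMem (by simp [hj])]
  · rfl

/-- `{a†ᵢ, a†ⱼ} = 0`. -/
theorem creation_anticomm (i j : Fin n) :
    creation i * creation j + creation j * creation i = 0 := by
  apply Matrix.ext_of_mulVec_single
  intro T
  rw [Matrix.add_mulVec, ← Matrix.mulVec_mulVec, ← Matrix.mulVec_mulVec,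
    creation_mulVec_single, creation_mulVec_single]
  by_cases hi : i ∈ T <;> by_cases hj : j ∈ T <;>
    simp only [hi, hj, if_true, if_false, Matrix.mulVec_zero, Matrix.mulVec_smul,
      creation_mulVec_single, Finset.mem_insert, or_true, smul_zero, add_zero, Matrix.zero_mulVec]
  rcases lt_trichotomy i j with h | h | h
  · simp [h.ne, h.ne', card_filter_insert_lt, hi, hj, h, h.not_gt, smul_smul,
      Finset.insert_comm i j, pow_succ]
    ring_nf
  · subst h; simp
  · simp [h.ne, h.ne', card_filter_insert_lt, hi, hj, h, h.not_gt, smul_smul,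
      Finset.insert_comm i j, pow_succ]
    ring_nf

theorem creation_swap (i j : Fin n) :
    creation i * creation j = -(creation j * creation i) :=
  eq_neg_of_add_eq_zero_left (creation_anticomm i j)

/-- `{a†ᵢ, aⱼ} = δᵢⱼ`. -/
theorem creation_annihilation_anticomm (i j : Fin n) :
    creation i * annihilation j + annihilation j * creation i = if i = j then 1 else 0 := by
  apply Matrix.ext_of_mulVec_single
  intro T
  rw [Matrix.add_mulVec, ← Matrix.mulVec_mulVec, ← Matrix.mulVec_mulVec,
    creation_mulVec_single, annihilation_mulVec_single]
  by_cases hij : i = j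
  · subst hij
    by_cases hi : i ∈ T
    · simp [-Matrix.mulVec_single, hi, Matrix.mulVec_smul, creation_mulVec_single, Finset.insert_erase hi, smul_smul,
        Finset.filter_erase, ← mul_pow]
    · simp [-Matrix.mulVec_single, hi, Matrix.mulVec_smul, annihilation_mulVec_single, smul_smul,
        Finset.filter_insert, ← mul_pow]
  · by_cases hi : i ∈ T <;> by_cases hj : j ∈ T
    · simp [-Matrix.mulVec_single, hi, hj, hij, Matrix.mulVec_smul, creation_mulVec_single]
    · simp [-Matrix.mulVec_single, hi, hj, hij]
    · obtain ⟨U, hU, rfl⟩ : ∃ U, j ∉ U ∧ insert j U = T :=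
        ⟨T.erase j, by simp, Finset.insert_erase hj⟩
      have hi' : i ∉ U := fun h => hi (by simp [-Matrix.mulVec_single, h])
      have hji : j ≠ i := fun h => hij h.symm
      have e : (insert i (insert j U)).erase j = insert i U := by
        rw [Finset.insert_comm, Finset.erase_insert (by simp [-Matrix.mulVec_single, hji, hU])]
      have h1 := card_filter_insert_lt (i := j) hi
      have h2 := card_filter_insert_lt (i := i) hU
      simp only [hi, hij, if_false, Finset.mem_insert, true_or, or_true, if_true,
        Matrix.mulVec_smul, creation_mulVec_single, annihilation_mulVec_single,
        Finset.erase_insert hU, hi', smul_smul, h1, h2, e, Matrix.zero_mulVec, ← add_smul]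
      rcases lt_or_gt_of_ne hij with h | h
      · simp [-Matrix.mulVec_single, h, h.not_gt, pow_succ, mul_comm]
      · simp [-Matrix.mulVec_single, h, h.not_gt, pow_succ, mul_comm]
    · simp [-Matrix.mulVec_single, hi, hj, hij, Matrix.mulVec_smul, annihilation_mulVec_single, Ne.symm hij]

theorem creationVec_swap (f g : Fin n → ℂ) :
    creationVec f * creationVec g = -(creationVec g * creationVec f) := by
  simp only [creationVec, Finset.sum_mul_sum]
  rw [Finset.sum_comm, ← Finset.sum_neg_distrib]
  refine Finset.sum_congr rfl fun j _ => ?_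
  rw [← Finset.sum_neg_distrib]
  refine Finset.sum_congr rfl fun i _ => ?_
  rw [smul_mul_smul_comm, smul_mul_smul_comm, creation_swap i j, smul_neg, mul_comm]

theorem creationVec_sq (f : Fin n → ℂ) : creationVec f * creationVec f = 0 := by
  ext S T
  have h := congrFun (congrFun (creationVec_swap f f) S) T
  exact self_eq_neg.mp h

theorem creationVec_mul_prod_eq_zero (b : Fin n → Fin n → ℂ) (i : Fin n) (l : List (Fin n))
    (h : i ∈ l) : creationVec (b i) * (l.map fun k => creationVec (b k)).prod = 0 := by
  induction l with
  | nil => simp at h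
  | cons k l ih =>
    rw [List.map_cons, List.prod_cons, ← mul_assoc]
    rcases List.mem_cons.mp h with rfl | h
    · rw [creationVec_sq, zero_mul]
    · rw [creationVec_swap, neg_mul, mul_assoc, ih h, mul_zero, neg_zero]

theorem prod_orderedInsert (b : Fin n → Fin n → ℂ) (i : Fin n) (l : List (Fin n)) (h : i ∉ l)
    (hl : l.Pairwise (· ≤ ·)) :
    creationVec (b i) * (l.map fun k => creationVec (b k)).prod =
      (-1 : ℂ) ^ (l.countP (· < i)) •
        ((l.orderedInsert (· ≤ ·) i).map fun k => creationVec (b k)).prod := by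
  induction l with
  | nil => simp
  | cons k l ih =>
    have hki : k ≠ i := fun e => h (by simp [e])
    have hil : i ∉ l := fun e => h (by simp [e])
    rw [List.pairwise_cons] at hl
    by_cases hik : i ≤ k
    · have h0 : (k :: l).countP (· < i) = 0 := by
        rw [List.countP_eq_zero]
        intro m hm
        rcases List.mem_cons.mp hm with rfl | hm
        · simpa using hik
        · simpa using hik.trans (hl.1 m hm)
      rw [h0, List.orderedInsert_cons_of_le _ _ hik]
      simp
    · have hlt : k < i := lt_of_not_ge hik
      rw [List.orderedInsert_of_not_le _ _ hik, List.map_cons, List.prod_cons, ← mul_assoc,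
        creationVec_swap, neg_mul, mul_assoc, ih hil hl.2, List.countP_cons_of_pos (by simpa),
        List.map_cons, List.prod_cons, pow_succ, mul_smul_comm]
      simp

theorem sort_insert_eq (i : Fin n) (T : Finset (Fin n)) (h : i ∉ T) :
    (insert i T).sort = T.sort.orderedInsert (· ≤ ·) i := by
  apply List.Perm.eq_of_pairwise (le := (· ≤ ·))
  · intro a b _ _ h1 h2; exact le_antisymm h1 h2
  · exact Finset.pairwise_sort _ _
  · exact (Finset.pairwise_sort T (· ≤ ·)).orderedInsert i _
  · refine List.Perm.trans ?_ (List.perm_orderedInsert _ i _).symm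
    rw [List.perm_ext_iff_of_nodup (Finset.sort_nodup _ _)
      (List.nodup_cons.mpr ⟨by simpa, Finset.sort_nodup _ _⟩)]
    simp

theorem countP_sort (i : Fin n) (T : Finset (Fin n)) :
    T.sort.countP (· < i) = (T.filter (· < i)).card := by
  rw [List.countP_eq_length_filter, ← List.toFinset_card_of_nodup]
  · congr 1
    ext; simp
  · exact (Finset.sort_nodup _ _).filter _

theorem totalMetric_mulVec_single (M : Matrix (Fin n) (Fin n) ℂ) (T : Finset (Fin n)) :
    totalMetric M *ᵥ Pi.single T 1 =
      (T.sort.map fun i => creationVec fun j => M j i).prod *ᵥ vacuum n := by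
  ext S
  simp [totalMetric]

theorem totalMetric_isTotalMetric (M : Matrix (Fin n) (Fin n) ℂ) :
    IsTotalMetric M (totalMetric M) := by
  constructor
  · intro i
    have key : ∑ j, M j i • (creation j * totalMetric M) =
        creationVec (fun j => M j i) * totalMetric M := by
      simp [creationVec, Finset.sum_mul]
    rw [key]
    apply Matrix.ext_of_mulVec_single
    intro T
    rw [← Matrix.mulVec_mulVec, ← Matrix.mulVec_mulVec, creation_mulVec_single,
      totalMetric_mulVec_single, Matrix.mulVec_mulVec]
    by_cases hi : i ∈ T
    · rw [creationVec_mul_prod_eq_zero (fun i j => M j i) i _ (by simpa using hi)]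
      simp [hi]
    · rw [prod_orderedInsert (fun i j => M j i) i _ (by simpa using hi) (Finset.pairwise_sort _ _),
        countP_sort, ← sort_insert_eq i T hi, if_neg hi, Matrix.mulVec_smul,
        totalMetric_mulVec_single, Matrix.smul_mulVec]
  · have := totalMetric_mulVec_single M ∅
    simpa [vacuum, -Matrix.mulVec_single] using this

/-- The total metric is the unique solution of its defining equations. -/
theorem isTotalMetric_iff (M : Matrix (Fin n) (Fin n) ℂ) (η : FockOp n) :
    IsTotalMetric M η ↔ η = totalMetric M := by
  refine ⟨fun h => ?_, fun h => h ▸ totalMetric_isTotalMetric M⟩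
  apply Matrix.ext_of_mulVec_single
  intro T
  have h' := totalMetric_isTotalMetric M
  induction T using Finset.induction_on with
  | empty => exact h.2.trans h'.2.symm
  | insert i T hi ih =>
    have step : ∀ ζ : FockOp n, IsTotalMetric M ζ →
        ζ *ᵥ Pi.single (insert i T) 1 = (-1 : ℂ) ^ (T.filter (· < i)).card •
          ((∑ j, M j i • creation j) *ᵥ (ζ *ᵥ Pi.single T 1)) := by
      intro ζ hζ
      have e : (∑ j, M j i • creation j) * ζ = ζ * creation i := by
        rw [hζ.1 i, Finset.sum_mul]; simp
      rw [Matrix.mulVec_mulVec, e, ← Matrix.mulVec_mulVec, creation_mulVec_single, if_neg hi,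
        Matrix.mulVec_smul, smul_smul, ← mul_pow]
      simp
    rw [step η h, step _ h', ih]

end facts

/-!
Everything reduces to linear algebra of the reduced metric `M`.

*From operators to vectors.* Conjugation by the total metric `η` maps `a†(g)` to `a†(M g)` and
`a(M g)` to `a(g)`. An even operator is local to `S` exactly if it commutes with the creation and
annihilation operators off `S`. If `O` is quasi-Hermitian and local to `A`, then `O† = η O η⁻¹`
also commutes with the modes off `A`, so `O` commutes in addition with `a†(M⁻¹ eⱼ)` and `a(M eⱼ)`,
`j ∉ A`. Let `N` be the space of all `v` such that `v` and `M v` are both supported in `A`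
(`biSupported`). If `vₖ = (M v)ₖ = 0` for all `v ∈ N`, then by duality `eₖ` is a combination of the
`eⱼ` and `M⁻¹ eⱼ`, and also of the `eⱼ` and `M eⱼ`, so `O` commutes with `a†ₖ` and `aₖ` and is local
to `A \ {k}` (`IsQuasiHermitian.mem_bkLocal_erase`). Conversely, if every `k ∈ A` is seen by some
`v` or `M v` with `v ∈ N`, then a generic `v ∈ N` is seen everywhere on `A`, and `a†(v) a(M v)` is
quasi-Hermitian and extensively local over `A`. This is
`exists_quasiHermitian_extensivelyLocal_iff`.

*The chain as a transfer problem.* For the metric at hand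
`(M v)ᵢ = vᵢ + i Im γ (Xᵢ - Yᵢ₊₁)`, where `X` collects `v` from the left with a factor `γ` per site
and `Y` collects it from the right with a factor `γ*`. Membership in `N` says that off `A` the
source `v` vanishes and `Xᵢ = Yᵢ₊₁` (`exists_mem_biSupported_iff`).

*Solving it.* A gap of `A` with at least two sites, or one that reaches an end of the chain,
carries only zero, as `|γ| ≠ 1`; so a single site next to such a gap, and an inner pair of sites
between two of them, is unseen (`siteConditions_of_exists_seen`). On the other hand, three
consecutive sites, and the two sites at an end of the chain, carry solutions of their own. Under
the conditions, an inner gap with a single site can carry any value `t`: a pair of sites absorbs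
it, a single site at an end of the chain absorbs it, and any other single site passes it on to the
next gap, multiplied by `(1 + γ²) / (1 + γ*²)` or its inverse (`exists_right_completion`). This
reaches all other sites (`SiteConditions.exists_seen`).

*Components.* `SiteConditions` is a reformulation of the four conditions on the components of `A`
in terms of the sites next to components with one or two sites.
-/

/-! ### Anticommutation with products -/

theorem mul_list_prod_of_anticomm {R : Type*} [Ring R] (X : R) (l : List R)
    (h : ∀ Y ∈ l, X * Y = -(Y * X)) : X * l.prod = (-1) ^ l.length * (l.prod * X) := by
  induction l with
  | nil => simp
  | cons Y l ih =>
    rw [List.prod_cons, ← mul_assoc, h Y (by simp), neg_mul, mul_assoc,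
      ih fun Z hZ => h Z (by simp [hZ]), List.length_cons, pow_succ]
    simp only [mul_neg, mul_one, neg_mul, neg_inj, ← mul_assoc]
    rw [((Commute.neg_one_right Y).pow_right l.length).eq]

theorem mul_list_prod_map_eq_zero {R ι : Type*} [Ring R] (f : ι → R)
    (hf : ∀ i j, f i * f j = -(f j * f i)) (hsq : ∀ i, f i * f i = 0) {k : ι} {l : List ι}
    (hk : k ∈ l) : f k * (l.map f).prod = 0 := by
  induction l with
  | nil => simp at hk
  | cons i l ih =>
    rw [List.map_cons, List.prod_cons, ← mul_assoc]
    rcases List.mem_cons.mp hk with rfl | hk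
    · rw [hsq, zero_mul]
    · rw [hf, neg_mul, mul_assoc, ih hk, mul_zero, neg_zero]

section operators

variable {n : ℕ}

theorem creation_sq (i : Fin n) : creation i * creation i = (0 : FockOp n) := by
  have h := creationVec_sq (Pi.single i (1 : ℂ))
  simpa [creationVec, Pi.single_apply] using h

theorem annihilation_swap (i j : Fin n) :
    annihilation i * annihilation j = -(annihilation j * annihilation i) := by
  simp only [annihilation, ← conjTranspose_mul, ← conjTranspose_neg]
  rw [creation_swap]

theorem annihilation_sq (i : Fin n) : annihilation i * annihilation i = (0 : FockOp n) := by
  simp only [annihilation, ← conjTranspose_mul, creation_sq, conjTranspose_zero]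

theorem annihilation_mul_creation_self (i : Fin n) :
    annihilation i * creation i = 1 - creation i * annihilation i := by
  have h := creation_annihilation_anticomm i i
  rw [if_pos rfl] at h
  rw [← h]; abel

theorem creation_annihilation_swap {i j : Fin n} (h : i ≠ j) :
    creation i * annihilation j = -(annihilation j * creation i) := by
  have h' := creation_annihilation_anticomm i j
  rw [if_neg h] at h'
  exact eq_neg_of_add_eq_zero_left h'

theorem creation_mul_creationProd {k : Fin n} {S : Finset (Fin n)} (hk : k ∈ S) :
    creation k * creationProd S = 0 :=
  mul_list_prod_map_eq_zero _ creation_swap creation_sq (by simpa using hk)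

theorem annihilationProd_mul_annihilation {k : Fin n} {S : Finset (Fin n)} (hk : k ∈ S) :
    annihilationProd S * annihilation k = 0 := by
  have h := mul_list_prod_map_eq_zero annihilation annihilation_swap annihilation_sq
    (l := S.sort) (k := k) (by simpa using hk)
  rw [mul_list_prod_of_anticomm] at h
  · rcases neg_one_pow_eq_or (FockOp n) (S.sort.map (annihilation (n := n))).length with e | e <;>
      rw [e] at h <;> simpa [annihilationProd] using h
  · simp only [List.mem_map]
    rintro _ ⟨j, -, rfl⟩
    exact annihilation_swap k j

/-! ### The commutant description of locality -/

/-- An even operator that is local to `S` commutes with everything that anticommutes with the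
generators at the sites of `S`. -/
theorem commute_of_mem_bkLocal {S : Finset (Fin n)} {O : FockOp n} (hO : O ∈ bkLocal S)
    {X : FockOp n} (h₁ : ∀ i ∈ S, X * creation i = -(creation i * X))
    (h₂ : ∀ i ∈ S, X * annihilation i = -(annihilation i * X)) : Commute X O := by
  induction hO using Submodule.span_induction with
  | mem O hO =>
    obtain ⟨A, B, hA, hB, hev, rfl⟩ := hO
    have e₁ := mul_list_prod_of_anticomm X (A.sort.map creation) (by
      simp only [List.mem_map]
      rintro _ ⟨j, hj, rfl⟩
      exact h₁ j (hA (by simpa using hj)))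
    have e₂ := mul_list_prod_of_anticomm X (B.sort.map annihilation) (by
      simp only [List.mem_map]
      rintro _ ⟨j, hj, rfl⟩
      exact h₂ j (hB (by simpa using hj)))
    simp only [List.length_map, Finset.length_sort] at e₁ e₂
    have c : ∀ (m : ℕ) (Y : FockOp n), Y * (-1) ^ m = (-1) ^ m * Y := fun m Y =>
      ((Commute.neg_one_right Y).pow_right m).eq
    unfold creationProd annihilationProd
    rw [commute_iff_eq, ← mul_assoc, e₁, mul_assoc, mul_assoc, e₂, ← mul_assoc _ (_ ^ _), c,
      ← mul_assoc, ← mul_assoc, ← mul_assoc, ← pow_add, hev.neg_one_pow, one_mul, mul_assoc]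
  | zero => exact Commute.zero_right _
  | add _ _ _ _ h h' => exact h.add_right h'
  | smul c _ _ h => exact h.smul_right c

theorem commute_creation_of_mem_bkLocal {S : Finset (Fin n)} {O : FockOp n} (hO : O ∈ bkLocal S)
    {k : Fin n} (hk : k ∉ S) : Commute (creation k) O :=
  commute_of_mem_bkLocal hO (fun i _ => creation_swap k i) fun _ hi =>
    creation_annihilation_swap fun e => hk (e ▸ hi)

theorem commute_annihilation_of_mem_bkLocal {S : Finset (Fin n)} {O : FockOp n}
    (hO : O ∈ bkLocal S) {k : Fin n} (hk : k ∉ S) : Commute (annihilation k) O :=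
  commute_of_mem_bkLocal hO (fun i hi => by
    have hik : i ≠ k := fun e => hk (e ▸ hi)
    rw [creation_annihilation_swap hik, neg_neg])
    fun i _ => annihilation_swap k i

/-- The compression of an operator to the states with empty site `k`, extended again to all states
so that it does not act on site `k`. -/
def emptySiteCompression (k : Fin n) (X : FockOp n) : FockOp n :=
  annihilation k * creation k * X * (annihilation k * creation k) +
    creation k * (annihilation k * creation k * X * (annihilation k * creation k)) * annihilation k

theorem emptySiteCompression_of_commute {k : Fin n} {X : FockOp n} (h₁ : Commute (creation k) X)
    (h₂ : Commute (annihilation k) X) : emptySiteCompression k X = X := by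
  set c : FockOp n := creation k
  set a : FockOp n := annihilation k
  have hac : a * c = 1 - c * a := annihilation_mul_creation_self k
  have hcc : c * c = 0 := creation_sq k
  have haa : a * a = 0 := annihilation_sq k
  have hP : a * c * (a * c) = a * c := by
    rw [hac, sub_mul, one_mul, ← hac, show c * a * (a * c) = c * (a * a) * c by noncomm_ring, haa]
    simp
  have hQ : c * (a * c) * a = c * a := by
    rw [hac, mul_sub, mul_one, ← mul_assoc, hcc]
    simp
  have hX : a * c * X = X * (a * c) := by rw [mul_assoc, h₁.eq, ← mul_assoc, h₂.eq, mul_assoc]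
  calc emptySiteCompression k X
      = a * c * X * (a * c) + c * (a * c * X * (a * c)) * a := rfl
    _ = X * (a * c * (a * c)) + X * (c * (a * c * (a * c)) * a) := by
      rw [hX, mul_assoc X, ← mul_assoc c X, h₁.eq]; simp only [mul_assoc]
    _ = X := by rw [hP, hQ, ← mul_add, hac, sub_add_cancel, mul_one]

theorem emptySiteCompression_mem {k : Fin n} {S : Finset (Fin n)} {X : FockOp n}
    (hX : X ∈ bkLocal S) : emptySiteCompression k X ∈ bkLocal (S.erase k) := by
  induction hX using Submodule.span_induction with
  | mem O hO =>
    obtain ⟨A, B, hA, hB, hev, rfl⟩ := hO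
    by_cases hkA : k ∈ A
    · have : annihilation k * creation k * (creationProd A * annihilationProd B) = 0 := by
        rw [mul_assoc, ← mul_assoc (creation k), creation_mul_creationProd hkA]; simp
      simp [emptySiteCompression, this]
    by_cases hkB : k ∈ B
    · have : creationProd A * annihilationProd B * (annihilation k * creation k) = 0 := by
        rw [mul_assoc, ← mul_assoc (annihilationProd B), annihilationProd_mul_annihilation hkB]
        simp
      simp [emptySiteCompression, mul_assoc _ (creationProd A * annihilationProd B), this]
    have hmem : creationProd A * annihilationProd B ∈ bkLocal (S.erase k) :=
      Submodule.subset_span ⟨A, B,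
        fun i hi => Finset.mem_erase.mpr ⟨fun e => hkA (e ▸ hi), hA hi⟩,
        fun i hi => Finset.mem_erase.mpr ⟨fun e => hkB (e ▸ hi), hB hi⟩, hev, rfl⟩
    rwa [emptySiteCompression_of_commute (commute_creation_of_mem_bkLocal hmem (by simp))
      (commute_annihilation_of_mem_bkLocal hmem (by simp))]
  | zero => simp [emptySiteCompression]
  | add X Y _ _ h h' =>
    have : emptySiteCompression k (X + Y) =
        emptySiteCompression k X + emptySiteCompression k Y := by
      simp only [emptySiteCompression, mul_add, add_mul]; abel
    exact this ▸ add_mem h h'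
  | smul c X _ h =>
    have : emptySiteCompression k (c • X) = c • emptySiteCompression k X := by
      simp only [emptySiteCompression, mul_smul_comm, smul_mul_assoc, smul_add]
    exact this ▸ Submodule.smul_mem _ c h

theorem mem_bkLocal_erase {k : Fin n} {S : Finset (Fin n)} {X : FockOp n} (hX : X ∈ bkLocal S)
    (h₁ : Commute (creation k) X) (h₂ : Commute (annihilation k) X) :
    X ∈ bkLocal (S.erase k) := by
  rw [← emptySiteCompression_of_commute h₁ h₂]
  exact emptySiteCompression_mem hX

/-! ### Linear combinations of creation and annihilation operators -/

/-- `a(g) = a†(g)† = ∑ᵢ gᵢ* aᵢ`, which is antilinear in `g`. -/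
def annihilationVec (g : Fin n → ℂ) : FockOp n := (creationVec g)ᴴ

theorem annihilationVec_eq (g : Fin n → ℂ) :
    annihilationVec g = ∑ i, star (g i) • annihilation i := by
  simp [annihilationVec, creationVec, annihilation, conjTranspose_sum]

theorem creationVec_add (f g : Fin n → ℂ) :
    creationVec (f + g) = creationVec f + creationVec g := by
  simp [creationVec, add_smul, Finset.sum_add_distrib]

theorem creationVec_smul (c : ℂ) (g : Fin n → ℂ) : creationVec (c • g) = c • creationVec g := by
  simp [creationVec, Finset.smul_sum, smul_smul]

theorem creationVec_zero : creationVec (0 : Fin n → ℂ) = 0 := by simp [creationVec]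

theorem creationVec_single (i : Fin n) : creationVec (Pi.single i 1) = creation i := by
  simp [creationVec, Pi.single_apply]

theorem annihilationVec_single (i : Fin n) : annihilationVec (Pi.single i 1) = annihilation i := by
  simp [annihilationVec, creationVec_single, annihilation]

theorem annihilationVec_mul_creation (g : Fin n → ℂ) (i : Fin n) :
    annihilationVec g * creation i = star (g i) • 1 - creation i * annihilationVec g := by
  have h : ∀ j, annihilation j * creation i = (if i = j then 1 else 0) -
      creation i * annihilation j := fun j => by
    rw [← creation_annihilation_anticomm i j]; abel
  simp only [annihilationVec_eq, Finset.sum_mul, Finset.mul_sum, smul_mul_assoc, h, smul_sub,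
    Finset.sum_sub_distrib, mul_smul_comm]
  simp

theorem annihilation_mul_creationVec (g : Fin n → ℂ) (i : Fin n) :
    annihilation i * creationVec g = g i • 1 - creationVec g * annihilation i := by
  have h := congrArg conjTranspose (annihilationVec_mul_creation g i)
  simpa [annihilationVec, annihilation] using h

theorem annihilationVec_mul_creationVec (f g : Fin n → ℂ) :
    annihilationVec f * creationVec g =
      (star f ⬝ᵥ g) • 1 - creationVec g * annihilationVec f := by
  simp only [creationVec, Finset.mul_sum, Finset.sum_mul, mul_smul_comm, smul_mul_assoc,
    annihilationVec_mul_creation, smul_sub, Finset.sum_sub_distrib, smul_smul, dotProduct,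
    Finset.sum_smul, Pi.star_apply, mul_comm]

theorem annihilationVec_eq_zero {g : Fin n → ℂ} (h : annihilationVec g = 0) : g = 0 := by
  funext i
  have := annihilationVec_mul_creation g i
  rw [h, zero_mul, mul_zero, sub_zero] at this
  simpa using (smul_eq_zero.mp this.symm).resolve_right one_ne_zero

theorem creationVec_eq_zero {g : Fin n → ℂ} (h : creationVec g = 0) : g = 0 :=
  annihilationVec_eq_zero (by rw [annihilationVec, h, conjTranspose_zero])

theorem annihilation_mul_annihilationVec (i : Fin n) (g : Fin n → ℂ) :
    annihilation i * annihilationVec g = -(annihilationVec g * annihilation i) := by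
  rw [← annihilationVec_single]
  simp only [annihilationVec, ← conjTranspose_mul, ← conjTranspose_neg]
  rw [creationVec_swap]

theorem creation_mul_creationVec (i : Fin n) (g : Fin n → ℂ) :
    creation i * creationVec g = -(creationVec g * creation i) := by
  rw [← creationVec_single, creationVec_swap]

theorem annihilationVec_mulVec_vacuum (g : Fin n → ℂ) :
    annihilationVec g *ᵥ vacuum n = 0 := by
  rw [annihilationVec_eq, Matrix.sum_mulVec]
  refine Finset.sum_eq_zero fun i _ => ?_
  rw [Matrix.smul_mulVec, vacuum, annihilation_mulVec_single]
  simp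

/-! ### The total metric -/

theorem totalMetric_mul_creationVec (M : Matrix (Fin n) (Fin n) ℂ) (g : Fin n → ℂ) :
    totalMetric M * creationVec g = creationVec (M *ᵥ g) * totalMetric M := by
  have h := (totalMetric_isTotalMetric M).1
  simp only [creationVec, Finset.mul_sum, mul_smul_comm, h, Finset.sum_mul, smul_mul_assoc,
    Finset.smul_sum, smul_smul, mulVec, dotProduct, Finset.sum_smul]
  rw [Finset.sum_comm]
  simp only [mul_comm]

theorem totalMetric_one : totalMetric (1 : Matrix (Fin n) (Fin n) ℂ) = 1 := by
  refine ((isTotalMetric_iff 1 1).mp ⟨fun i => ?_, by simp⟩).symm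
  simp [Matrix.one_apply]

theorem totalMetric_mul (M N : Matrix (Fin n) (Fin n) ℂ) :
    totalMetric (M * N) = totalMetric M * totalMetric N := by
  refine ((isTotalMetric_iff _ _).mp ⟨fun i => ?_, ?_⟩).symm
  · have e : ∑ j, (M * N) j i • (creation j * (totalMetric M * totalMetric N)) =
        creationVec (M *ᵥ (N *ᵥ Pi.single i 1)) * (totalMetric M * totalMetric N) := by
      rw [mulVec_mulVec, mulVec_single_one]
      simp [creationVec, Finset.sum_mul]
    rw [e, ← creationVec_single, mul_assoc, totalMetric_mul_creationVec, ← mul_assoc,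
      totalMetric_mul_creationVec, mul_assoc]
  · rw [← mulVec_mulVec, (totalMetric_isTotalMetric N).2, (totalMetric_isTotalMetric M).2]

theorem totalMetric_inv_mul {M : Matrix (Fin n) (Fin n) ℂ} (hM : IsUnit M.det) :
    totalMetric M⁻¹ * totalMetric M = 1 := by
  rw [← totalMetric_mul, Matrix.nonsing_inv_mul _ hM, totalMetric_one]

/-- The intertwining relation for annihilation operators; it is the adjoint of the one for creation
operators once the total metric is known to be Hermitian, but is obtained here by induction on the
number of particles. -/
theorem annihilationVec_mul_totalMetric {M : Matrix (Fin n) (Fin n) ℂ} (hM : M.IsHermitian)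
    (g : Fin n → ℂ) :
    annihilationVec g * totalMetric M = totalMetric M * annihilationVec (M *ᵥ g) := by
  apply Matrix.ext_of_mulVec_single
  intro T
  induction T using Finset.induction_on with
  | empty =>
    have h0 := (totalMetric_isTotalMetric M).2
    rw [← mulVec_mulVec, ← mulVec_mulVec]
    change _ *ᵥ _ *ᵥ vacuum n = _ *ᵥ _ *ᵥ vacuum n
    rw [h0, annihilationVec_mulVec_vacuum, annihilationVec_mulVec_vacuum, mulVec_zero]
  | insert i T hi ih =>
    have key : ∀ X : FockOp n, X *ᵥ Pi.single (insert i T) 1 =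
        (-1 : ℂ) ^ (T.filter (· < i)).card • ((X * creation i) *ᵥ Pi.single T 1) := by
      intro X
      rw [← mulVec_mulVec, creation_mulVec_single, if_neg hi, mulVec_smul, smul_smul, ← mul_pow]
      simp
    have e : star g ⬝ᵥ (M *ᵥ Pi.single i 1) = star ((M *ᵥ g) i) := by
      have : star ((M *ᵥ g) i) = star (M *ᵥ g) ⬝ᵥ Pi.single i 1 := by simp
      rw [this, star_mulVec, hM.eq, dotProduct_mulVec]
    rw [key, key, mul_assoc, ← creationVec_single, totalMetric_mul_creationVec, ← mul_assoc,
      annihilationVec_mul_creationVec, mul_assoc, creationVec_single, annihilationVec_mul_creation,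
      e, mul_sub, sub_mul, mul_smul_comm, mul_one, smul_mul_assoc, one_mul, mul_assoc,
      ← mul_assoc (totalMetric M), ← creationVec_single, totalMetric_mul_creationVec, mul_assoc,
      sub_mulVec, sub_mulVec, ← mulVec_mulVec (M := creationVec _), ih, mulVec_mulVec]

/-! ### Extensively local quasi-Hermitian operators and the reduced metric -/

/-- The space of vectors `v` such that both `v` and `M v` are supported in `A`. -/
def biSupported (M : Matrix (Fin n) (Fin n) ℂ) (A : Finset (Fin n)) :
    Submodule ℂ (Fin n → ℂ) where
  carrier := {v | ∀ i ∉ A, v i = 0 ∧ (M *ᵥ v) i = 0}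
  add_mem' {v w} hv hw i hi := by simp [mulVec_add, hv i hi, hw i hi]
  zero_mem' i _ := by simp
  smul_mem' c v hv i hi := by simp [mulVec_smul, hv i hi]

/-- Duality: the orthogonal complement of `biSupported M A` is spanned by the `eⱼ` and `M eⱼ` with
`j ∉ A`. -/
theorem single_mem_of_biSupported {M : Matrix (Fin n) (Fin n) ℂ} (hM : M.IsHermitian)
    {A : Finset (Fin n)} {k : Fin n} (hk : ∀ v ∈ biSupported M A, v k = 0)
    (G : Submodule ℂ (Fin n → ℂ)) (h₁ : ∀ j ∉ A, Pi.single j 1 ∈ G)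
    (h₂ : ∀ j ∉ A, M *ᵥ Pi.single j 1 ∈ G) : (Pi.single k 1 : Fin n → ℂ) ∈ G := by
  by_contra hG
  obtain ⟨φ, hφ, hle⟩ := Submodule.exists_le_ker_of_notMem hG
  let w : Fin n → ℂ := fun i => star (φ (Pi.single i 1))
  have hrep : ∀ x, φ x = star w ⬝ᵥ x := by
    intro x
    conv_lhs => rw [pi_eq_sum_univ' x]
    simp [dotProduct, w, mul_comm, map_sum]
  refine hφ ?_
  have hw : w ∈ biSupported M A := by
    intro j hj
    have e₁ : φ (Pi.single j 1) = 0 := hle (h₁ j hj)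
    have e₂ : φ (M *ᵥ Pi.single j 1) = 0 := hle (h₂ j hj)
    refine ⟨by simp [w, e₁], ?_⟩
    rw [hrep, dotProduct_mulVec, ← hM.eq, ← star_mulVec] at e₂
    simpa using e₂
  simpa [w] using hk w hw

/-- The rank-one one-body operator `a†(v) a(M v)` is quasi-Hermitian. -/
theorem isQuasiHermitian_creationVec_mul {M : Matrix (Fin n) (Fin n) ℂ} (hM : M.IsHermitian)
    (v : Fin n → ℂ) :
    IsQuasiHermitian (totalMetric M) (creationVec v * annihilationVec (M *ᵥ v)) := by
  have e : (creationVec v * annihilationVec (M *ᵥ v))ᴴ =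
      creationVec (M *ᵥ v) * annihilationVec v := by
    simp [annihilationVec]
  rw [IsQuasiHermitian, e, ← mul_assoc, totalMetric_mul_creationVec, mul_assoc, mul_assoc,
    annihilationVec_mul_totalMetric hM]

theorem creationVec_mul_annihilationVec_mem {S : Finset (Fin n)} {v w : Fin n → ℂ}
    (hv : ∀ i ∉ S, v i = 0) (hw : ∀ i ∉ S, w i = 0) :
    creationVec v * annihilationVec w ∈ bkLocal S := by
  rw [annihilationVec_eq, creationVec, Finset.sum_mul_sum]
  refine Submodule.sum_mem _ fun i _ => Submodule.sum_mem _ fun j _ => ?_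
  rw [smul_mul_smul_comm]
  by_cases hi : i ∈ S
  · by_cases hj : j ∈ S
    · refine Submodule.smul_mem _ _ (Submodule.subset_span ⟨{i}, {j}, by simpa, by simpa, ?_, ?_⟩)
      · simp
      · simp [creationProd, annihilationProd]
    · simp [hw j hj]
  · simp [hv i hi]

theorem not_mem_bkLocal_of_ne_zero {S : Finset (Fin n)} {v w : Fin n → ℂ} (hv : v ≠ 0)
    (hw : w ≠ 0) {k : Fin n} (hk : k ∉ S) (h : v k ≠ 0 ∨ w k ≠ 0) :
    creationVec v * annihilationVec w ∉ bkLocal S := by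
  intro hO
  rcases h with h | h
  · have hc := (commute_annihilation_of_mem_bkLocal hO hk).eq
    rw [← mul_assoc, annihilation_mul_creationVec, sub_mul, mul_assoc, mul_assoc,
      annihilation_mul_annihilationVec, mul_neg, sub_neg_eq_add, add_eq_right, smul_mul_assoc,
      one_mul, smul_eq_zero] at hc
    exact hw (annihilationVec_eq_zero (hc.resolve_left h))
  · have hc := (commute_creation_of_mem_bkLocal hO hk).eq
    rw [← mul_assoc, creation_mul_creationVec, mul_assoc _ _ (creation k),
      annihilationVec_mul_creation, mul_sub, neg_mul, mul_assoc, mul_smul_comm, mul_one,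
      neg_eq_iff_add_eq_zero, add_sub_cancel, smul_eq_zero] at hc
    exact hv (creationVec_eq_zero (hc.resolve_left (by simpa using h)))

/-- If a quasi-Hermitian operator is local to `A`, and site `k` is invisible to all `v` and `M v`
with `v ∈ biSupported M A`, then the operator is already local to `A \ {k}`. -/
theorem IsQuasiHermitian.mem_bkLocal_erase {M : Matrix (Fin n) (Fin n) ℂ} (hM : M.PosDef)
    {A : Finset (Fin n)} {O : FockOp n} (hq : IsQuasiHermitian (totalMetric M) O)
    (hO : O ∈ bkLocal A) {k : Fin n}
    (hk : ∀ v ∈ biSupported M A, v k = 0 ∧ (M *ᵥ v) k = 0) : O ∈ bkLocal (A.erase k) := by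
  have hdet : IsUnit M.det := (Matrix.isUnit_iff_isUnit_det M).mp hM.isUnit
  have hη := totalMetric_inv_mul hdet
  set η := totalMetric M
  have hcancel : ∀ X Y : FockOp n, η * X = η * Y → X = Y := fun X Y h => by
    rw [← one_mul X, ← hη, mul_assoc, h, ← mul_assoc, hη, one_mul]
  have hq' : η * O = Oᴴ * η := hq
  have hcre : ∀ j ∉ A, Commute (creation j) O := fun j hj => commute_creation_of_mem_bkLocal hO hj
  have hann : ∀ j ∉ A, Commute (annihilation j) O :=
    fun j hj => commute_annihilation_of_mem_bkLocal hO hj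
  have hcre' : ∀ j ∉ A, Commute (creation j) Oᴴ := fun j hj => by
    have := congrArg conjTranspose (hann j hj).eq
    simp only [conjTranspose_mul, annihilation, conjTranspose_conjTranspose] at this
    exact this.symm
  have hann' : ∀ j ∉ A, Commute (annihilation j) Oᴴ := fun j hj => by
    have := congrArg conjTranspose (hcre j hj).eq
    simp only [conjTranspose_mul] at this
    exact this.symm
  -- Conjugating `Oᴴ` by the total metric shows that `O` also commutes with the transported modes.
  have hcre₂ : ∀ j ∉ A, Commute (creationVec (M⁻¹ *ᵥ Pi.single j 1)) O := fun j hj => by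
    refine hcancel _ _ ?_
    rw [← mul_assoc, totalMetric_mul_creationVec, mulVec_mulVec, Matrix.mul_nonsing_inv _ hdet,
      one_mulVec, creationVec_single, mul_assoc, hq', ← mul_assoc, (hcre' j hj).eq, ← mul_assoc,
      hq', mul_assoc, mul_assoc, totalMetric_mul_creationVec, mulVec_mulVec,
      Matrix.mul_nonsing_inv _ hdet, one_mulVec, creationVec_single]
  have hann₂ : ∀ j ∉ A, Commute (annihilationVec (M *ᵥ Pi.single j 1)) O := fun j hj => by
    refine hcancel _ _ ?_
    rw [← mul_assoc, ← annihilationVec_mul_totalMetric hM.1, annihilationVec_single, mul_assoc, hq',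
      ← mul_assoc, (hann' j hj).eq, ← mul_assoc, hq', mul_assoc, mul_assoc,
      ← annihilationVec_mul_totalMetric hM.1, annihilationVec_single]
  let G₁ : Submodule ℂ (Fin n → ℂ) :=
    { carrier := {g | Commute (creationVec g) O}
      add_mem' := fun {f g} hf hg => by
        change Commute _ _
        rw [creationVec_add]; exact hf.add_left hg
      zero_mem' := by
        change Commute _ _
        rw [creationVec_zero]; exact Commute.zero_left _
      smul_mem' := fun c g hg => by
        change Commute _ _
        rw [creationVec_smul]; exact hg.smul_left c }
  let G₂ : Submodule ℂ (Fin n → ℂ) :=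
    { carrier := {g | Commute (annihilationVec g) O}
      add_mem' := fun {f g} hf hg => by
        change Commute _ _
        rw [annihilationVec, creationVec_add, conjTranspose_add]; exact hf.add_left hg
      zero_mem' := by
        change Commute _ _
        rw [annihilationVec, creationVec_zero, conjTranspose_zero]; exact Commute.zero_left _
      smul_mem' := fun c g hg => by
        change Commute _ _
        rw [annihilationVec, creationVec_smul, conjTranspose_smul]; exact hg.smul_left _ }
  have hM' : M⁻¹.IsHermitian := hM.1.inv
  have k₁ : (Pi.single k 1 : Fin n → ℂ) ∈ G₁ := by
    refine single_mem_of_biSupported hM' (A := A) ?_ G₁ (fun j hj => ?_) hcre₂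
    · intro w hw
      have e : M *ᵥ (M⁻¹ *ᵥ w) = w := by
        rw [mulVec_mulVec, Matrix.mul_nonsing_inv _ hdet, one_mulVec]
      have := (hk (M⁻¹ *ᵥ w) fun i hi => ⟨(hw i hi).2, by rw [e]; exact (hw i hi).1⟩).2
      rwa [e] at this
    · change Commute _ _
      rw [creationVec_single]; exact hcre j hj
  have k₂ : (Pi.single k 1 : Fin n → ℂ) ∈ G₂ := by
    refine single_mem_of_biSupported hM.1 (A := A) (fun v hv => (hk v hv).1) G₂
      (fun j hj => ?_) hann₂
    change Commute _ _
    rw [annihilationVec_single]; exact hann j hj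
  have k₁' : Commute (creationVec (Pi.single k 1)) O := k₁
  have k₂' : Commute (annihilationVec (Pi.single k 1)) O := k₂
  rw [creationVec_single] at k₁'
  rw [annihilationVec_single] at k₂'
  exact _root_.mem_bkLocal_erase hO k₁' k₂'

/-- Existence of an extensively local quasi-Hermitian operator is a question about the reduced
metric: every site of `A` must be seen by some `v` or `M v` with `v ∈ biSupported M A`. -/
theorem exists_quasiHermitian_extensivelyLocal_iff {M : Matrix (Fin n) (Fin n) ℂ} (hM : M.PosDef)
    (A : Finset (Fin n)) :
    (∃ O : FockOp n, IsQuasiHermitian (totalMetric M) O ∧ IsBKExtensivelyLocal A O) ↔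
      ∀ k ∈ A, ∃ v ∈ biSupported M A, v k ≠ 0 ∨ (M *ᵥ v) k ≠ 0 := by
  constructor
  · rintro ⟨O, hq, hO, hmin⟩ k hk
    by_contra! hcon
    exact hmin _ (Finset.erase_ssubset hk) (hq.mem_bkLocal_erase hM hO hcon)
  · intro h
    -- A generic `v` is seen at all sites of `A` at once.
    choose! u hu hu' using h
    classical
    let f : A → Module.Dual ℂ (Fin n → ℂ) := fun k =>
      if u k k ≠ 0 then LinearMap.proj k.1 else (LinearMap.proj k.1).comp M.mulVecLin
    obtain ⟨v, hv, hfv⟩ := Module.Dual.exists_forall_mem_ne_zero_of_forall_exists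
      (biSupported M A) f fun k => ⟨u k, hu k k.2, by
        by_cases h0 : u k k ≠ 0
        · simp [f, h0]
        · have := (hu' k k.2).resolve_left h0
          simp only [f, if_neg h0]
          simpa using this⟩
    refine ⟨creationVec v * annihilationVec (M *ᵥ v), isQuasiHermitian_creationVec_mul hM.1 v,
      creationVec_mul_annihilationVec_mem (fun i hi => (hv i hi).1) (fun i hi => (hv i hi).2),
      fun S hS => ?_⟩
    obtain ⟨k, hkA, hkS⟩ := Finset.exists_of_ssubset hS
    have hk : v k ≠ 0 ∨ (M *ᵥ v) k ≠ 0 := by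
      have := hfv ⟨k, hkA⟩
      by_cases h0 : u k k ≠ 0
      · left; simpa [f, h0] using this
      · right
        simp only [f, if_neg h0] at this
        simpa using this
    have hv0 : v ≠ 0 := by
      rintro rfl; simp at hk
    have hw0 : M *ᵥ v ≠ 0 := fun h0 => hv0 <| by
      have hdet : IsUnit M.det := (Matrix.isUnit_iff_isUnit_det M).mp hM.isUnit
      rw [← one_mulVec v, ← Matrix.nonsing_inv_mul _ hdet, ← mulVec_mulVec, h0, mulVec_zero]
    exact not_mem_bkLocal_of_ne_zero hv0 hw0 hkS hk

end operators

/-! ### Transfer sequences -/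

/-- The transfer equations at site `i` for a set of sites `P`. With `v = X (i + 1) - γ X i` the
value of the vector at `i`, the sequence `X` propagates to the right with factor `γ`, the sequence
`Y` to the left with factor `δ`, both with source `v`; off `P` the source vanishes and the
incoming values `X i` and `Y (i + 1)` agree. -/
def TransferAt (γ δ : ℂ) (P : ℕ → Prop) (X Y : ℕ → ℂ) (i : ℕ) : Prop :=
  X (i + 1) - γ * X i = Y i - δ * Y (i + 1) ∧
    (¬ P i → X (i + 1) = γ * X i ∧ X i = Y (i + 1))

/-- A solution of the transfer equations on the sites `0, …, n - 1`, with nothing coming in from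
either end. -/
structure IsTransferSolution (n : ℕ) (γ δ : ℂ) (P : ℕ → Prop) (X Y : ℕ → ℂ) : Prop where
  left : X 0 = 0
  right : Y n = 0
  site : ∀ i < n, TransferAt γ δ P X Y i

/-- Site `k` is seen by the sequences `X`, `Y`: the source at `k` is not zero, or the incoming
values differ. -/
def IsSeen (γ : ℂ) (X Y : ℕ → ℂ) (k : ℕ) : Prop := X (k + 1) ≠ γ * X k ∨ X k ≠ Y (k + 1)

/-- The non-degeneracy of a pair of transfer factors that is needed; it is symmetric and holds for
`(γ, γ*)` if `γ` is neither zero nor of modulus one. -/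
structure IsGenericPair (γ δ : ℂ) : Prop where
  left_ne : γ ≠ 0
  right_ne : δ ≠ 0
  one_sub : 1 - γ * δ ≠ 0
  one_add : 1 + γ * δ ≠ 0
  left_sq : 1 + γ ^ 2 ≠ 0
  right_sq : 1 + δ ^ 2 ≠ 0
  left_cube : 1 + δ * γ ^ 3 ≠ 0
  right_cube : 1 + γ * δ ^ 3 ≠ 0

theorem IsGenericPair.symm {γ δ : ℂ} (h : IsGenericPair γ δ) : IsGenericPair δ γ where
  left_ne := h.right_ne
  right_ne := h.left_ne
  one_sub := mul_comm γ δ ▸ h.one_sub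
  one_add := mul_comm γ δ ▸ h.one_add
  left_sq := h.right_sq
  right_sq := h.left_sq
  left_cube := h.right_cube
  right_cube := h.left_cube

theorem isGenericPair_star {γ : ℂ} (h0 : γ ≠ 0) (h1 : ‖γ‖ ≠ 1) :
    IsGenericPair γ (starRingEnd ℂ γ) := by
  -- Each expression vanishes only if `γ` or a product of `γ` and `γ*` has modulus one.
  have aux : ∀ (z : ℂ) (m : ℕ), m ≠ 0 → ‖z‖ = ‖γ‖ ^ m → 1 + z ≠ 0 := by
    intro z m hm hz h
    have : ‖z‖ = 1 := by rw [eq_neg_of_add_eq_zero_right h]; simp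
    exact h1 ((pow_eq_one_iff_of_nonneg (norm_nonneg γ) hm).mp (hz ▸ this))
  refine ⟨h0, by simpa using h0, ?_, aux _ 2 two_ne_zero ?_, aux _ 2 two_ne_zero ?_,
    aux _ 2 two_ne_zero ?_, aux _ 4 four_ne_zero ?_, aux _ 4 four_ne_zero ?_⟩
  · rw [sub_eq_add_neg]
    exact aux _ 2 two_ne_zero (by simp [sq])
  all_goals simp; try ring

/-- The conditions on a set `P` of sites among `0, …, n - 1`, in terms of the neighbours of the
components with one and with two sites. -/
structure SiteConditions (n : ℕ) (P : ℕ → Prop) : Prop where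
  lt : ∀ i, P i → i < n
  single : ∀ i, P i → (∀ j, j + 1 = i → ¬ P j) → ¬ P (i + 1) →
    (i = 0 ∨ ∃ j, j + 2 = i ∧ P j) ∧ (i + 1 = n ∨ P (i + 2))
  pair : ∀ p, P p → P (p + 1) → (∀ j, j + 1 = p → ¬ P j) → ¬ P (p + 2) →
    p = 0 ∨ p + 2 = n ∨ (∃ j, j + 2 = p ∧ P j) ∨ P (p + 3)

section

variable {n : ℕ} {γ δ : ℂ} {P : ℕ → Prop}

theorem TransferAt.reflect {X Y : ℕ → ℂ} {i j : ℕ} (hij : j + i + 1 = n)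
    (h : TransferAt δ γ (fun m => m < n ∧ P (n - 1 - m)) X Y j) :
    TransferAt γ δ P (fun m => Y (n - m)) (fun m => X (n - m)) i := by
  have e₁ : n - (i + 1) = j := by omega
  have e₂ : n - i = j + 1 := by omega
  have e₃ : n - 1 - j = i := by omega
  obtain ⟨h₁, h₂⟩ := h
  simp only [e₃, not_and] at h₂
  refine ⟨by simp only [e₁, e₂]; exact h₁.symm, fun hi => ?_⟩
  obtain ⟨h₃, h₄⟩ := h₂ fun _ => hi
  simp only [e₁, e₂]
  refine ⟨?_, h₄.symm⟩
  rw [h₃, sub_self] at h₁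
  exact sub_eq_zero.mp h₁.symm

/-! ### Sufficiency of the conditions -/

/-- To the right of a gap site `g` the transfer equations have a solution with an arbitrary value
`t` at the gap: cross single sites until a component with two sites or the end of the chain
absorbs the value. -/
theorem exists_right_completion (hγ : IsGenericPair γ δ)
    (hlt : ∀ i, P i → i < n)
    (hs : ∀ i, P i → (∀ j, j + 1 = i → ¬ P j) → ¬ P (i + 1) → i + 1 = n ∨ P (i + 2))
    (g : ℕ) (hg : ¬ P g) (hg' : P (g + 1)) (t : ℂ) (ht : t ≠ 0) :
    ∃ X Y : ℕ → ℂ, X (g + 1) = γ * t ∧ Y (g + 1) = t ∧ Y n = 0 ∧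
      (∀ i, g < i → i < n → TransferAt γ δ P X Y i) ∧ X (g + 2) ≠ γ * X (g + 1) ∧
      (P (g + 2) → X (g + 3) ≠ γ * X (g + 2)) := by
  have hgn := hlt _ hg'
  obtain ⟨d, hd⟩ : ∃ d, d = n - g := ⟨_, rfl⟩
  induction d using Nat.strong_induction_on generalizing g t with
  | _ d ih =>
  by_cases hP : P (g + 2)
  · have hgn' := hlt _ hP
    have h1 := hγ.one_sub
    -- The sources at `g + 1` and `g + 2` that absorb the value of the gap solve a linear system
    -- of determinant `1 - γ δ`.
    set v₁ := t * (1 + δ * γ ^ 3) / (1 - γ * δ) with hv₁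
    set v₂ := -γ * (1 + γ ^ 2) * t / (1 - γ * δ) with hv₂
    have m₁ : v₁ * (1 - γ * δ) = t * (1 + δ * γ ^ 3) := div_mul_cancel₀ _ h1
    have m₂ : v₂ * (1 - γ * δ) = -γ * (1 + γ ^ 2) * t := div_mul_cancel₀ _ h1
    have ev₁ : v₁ = t - δ * v₂ := mul_right_cancel₀ h1 (by linear_combination m₁ + δ * m₂)
    have ev₂ : v₂ = -γ * (γ * (γ * t) + v₁) :=
      mul_right_cancel₀ h1 (by linear_combination m₂ + γ * m₁)
    have hv₁0 : v₁ ≠ 0 := div_ne_zero (mul_ne_zero ht hγ.left_cube) h1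
    have hv₂0 : v₂ ≠ 0 :=
      div_ne_zero (mul_ne_zero (mul_ne_zero (neg_ne_zero.mpr hγ.left_ne) hγ.left_sq) ht) h1
    refine ⟨fun m => if m ≤ g + 1 then γ * t else if m = g + 2 then γ * (γ * t) + v₁ else 0,
      fun m => if m ≤ g + 1 then t else if m = g + 2 then v₂ else 0, by simp, by simp, ?_, ?_, ?_,
      fun _ => ?_⟩
    · simp only [if_neg (show ¬ n ≤ g + 1 by omega), if_neg (show n ≠ g + 2 by omega)]
    · intro i hi hin
      obtain rfl | rfl | hi' : i = g + 1 ∨ i = g + 2 ∨ g + 3 ≤ i := by omega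
      · refine ⟨?_, fun h => absurd hg' h⟩
        simp
        rw [ev₁]
      · refine ⟨?_, fun h => absurd hP h⟩
        simp
        rw [ev₂]; ring
      · have a₁ : ¬ i ≤ g := by omega
        have a₂ : i ≠ g + 1 := by omega
        have a₃ : i ≠ g + 2 := by omega
        have a₄ : ¬ i ≤ g + 1 := by omega
        simp [TransferAt, a₁, a₂, a₃, a₄]
    · simpa using hv₁0
    · rw [ev₂] at hv₂0
      simpa using hv₂0
  · by_cases hn : g + 2 = n
    · refine ⟨fun m => if m ≤ g + 1 then γ * t else t + γ * (γ * t),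
        fun m => if m ≤ g + 1 then t else 0, by simp, by simp, ?_, ?_, ?_, fun h => absurd h hP⟩
      · simp only [if_neg (show ¬ n ≤ g + 1 by omega)]
      · intro i hi hin
        obtain rfl : i = g + 1 := by omega
        refine ⟨?_, fun h => absurd hg' h⟩
        simp
      · simpa using ht
    · have hP3 : P (g + 3) := by
        refine (hs (g + 1) hg' (fun j hj => ?_) hP).resolve_left hn
        obtain rfl : j = g := by omega
        exact hg
      -- The value at the next gap, for which the two expressions for the source at `g + 1` agree.
      set t' := t * (1 + γ ^ 2) / (1 + δ ^ 2) with ht'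
      have h2 := hγ.right_sq
      have ht'0 : t' ≠ 0 := div_ne_zero (mul_ne_zero ht hγ.left_sq) h2
      have et : t' - γ * (γ * t) = t - δ * (δ * t') := by rw [ht']; field_simp; ring
      obtain ⟨X, Y, hX, hY, hYn, hsite, -⟩ :=
        ih (n - (g + 2)) (by omega) (g + 2) hP hP3 t' ht'0 (by have := hlt _ hP3; omega) rfl
      have hn3 := hlt _ hP3
      refine ⟨fun m => if m ≤ g + 1 then γ * t else if m = g + 2 then t' else X m,
        fun m => if m ≤ g + 1 then t else if m = g + 2 then δ * t' else Y m, by simp, by simp, ?_,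
        ?_, ?_, fun h => absurd h hP⟩
      · simpa only [if_neg (show ¬ n ≤ g + 1 by omega), if_neg (show n ≠ g + 2 by omega)]
      · intro i hi hin
        obtain rfl | rfl | hi' : i = g + 1 ∨ i = g + 2 ∨ g + 2 < i := by omega
        · refine ⟨?_, fun h => absurd hg' h⟩
          simpa using et
        · simp [TransferAt, hX, hY]
        · have a₁ : ¬ i ≤ g := by omega
          have a₂ : i ≠ g + 1 := by omega
          have a₃ : i ≠ g + 2 := by omega
          have a₄ : ¬ i ≤ g + 1 := by omega
          simpa [TransferAt, a₁, a₂, a₃, a₄] using hsite i hi' hin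
      · simp only [le_refl, if_true, if_neg (show ¬ g + 2 ≤ g + 1 by omega)]
        intro h
        have : t * ((1 - γ * δ) * (1 + γ * δ)) = 0 := by
          have e : t' * (1 + δ ^ 2) = t * (1 + γ ^ 2) := by rw [ht']; field_simp
          rw [h] at e
          linear_combination -e
        exact mul_ne_zero ht (mul_ne_zero hγ.one_sub hγ.one_add) this

/-- The mirror image of `exists_right_completion`. -/
theorem exists_left_completion (hγ : IsGenericPair γ δ)
    (hlt : ∀ i, P i → i < n)
    (hs : ∀ i, P i → (∀ j, j + 1 = i → ¬ P j) → ¬ P (i + 1) → i = 0 ∨ ∃ j, j + 2 = i ∧ P j)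
    (g : ℕ) (hgn : g + 1 < n) (hg : ¬ P (g + 1)) (hg' : P g) (t : ℂ) (ht : t ≠ 0) :
    ∃ X Y : ℕ → ℂ, X (g + 1) = t ∧ Y (g + 1) = δ * t ∧ X 0 = 0 ∧
      (∀ i ≤ g, TransferAt γ δ P X Y i) ∧ X (g + 1) ≠ γ * X g ∧
      (∀ j, j + 1 = g → P j → X (j + 1) ≠ γ * X j) := by
  obtain ⟨g', hg'n⟩ : ∃ g', g' + g + 2 = n := ⟨n - (g + 2), by omega⟩
  obtain ⟨X, Y, hX, hY, hYn, hsite, h₁, h₂⟩ := exists_right_completion (n := n)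
    (P := fun m => m < n ∧ P (n - 1 - m)) hγ.symm (fun i hi => hi.1) (by
      rintro i ⟨hin, hi⟩ hl hr
      have hr' : ∀ j, j + 1 = n - 1 - i → ¬ P j := fun j hj hPj =>
        hr ⟨by omega, by rwa [show n - 1 - (i + 1) = j by omega]⟩
      have hl' : ¬ P (n - 1 - i + 1) := fun hPj => by
        have := hlt _ hPj
        exact hl (i - 1) (by omega) ⟨by omega, by
          rwa [show n - 1 - (i - 1) = n - 1 - i + 1 by omega]⟩
      rcases hs _ hi hr' hl' with h | ⟨j, hj, hPj⟩
      · left; omega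
      · right
        exact ⟨by omega, by rwa [show n - 1 - (i + 2) = j by omega]⟩)
    g' (by rw [show n - 1 - g' = g + 1 by omega]; exact fun h => hg h.2)
    ⟨by omega, by rwa [show n - 1 - (g' + 1) = g by omega]⟩ t ht
  have e₁ : n - (g + 1) = g' + 1 := by omega
  have e₂ : n - g = g' + 2 := by omega
  have hrefl : ∀ i ≤ g, TransferAt γ δ P (fun m => Y (n - m)) (fun m => X (n - m)) i :=
    fun i hi => (hsite (n - 1 - i) (by omega) (by omega)).reflect (by omega)
  refine ⟨fun m => Y (n - m), fun m => X (n - m), by simp only [e₁, hY], by simp only [e₁, hX],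
    by simpa using hYn, hrefl, ?_, ?_⟩
  · have h := (hrefl g le_rfl).1
    simp only [e₁, e₂] at h ⊢
    rw [← sub_ne_zero, h]
    exact sub_ne_zero.mpr h₁
  · rintro j hj hPj
    have e₃ : n - j = g' + 3 := by omega
    have e₄ : n - (j + 1) = g' + 2 := by omega
    have h := (hrefl j (by omega)).1
    simp only [e₃, e₄] at h ⊢
    rw [← sub_ne_zero, h]
    exact sub_ne_zero.mpr (h₂ ⟨by omega, by rwa [show n - 1 - (g' + 2) = j by omega]⟩)

/-- Two completions fit together at a gap with the single site `g + 1`. -/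
theorem exists_transferSolution_through_gap (hγ : IsGenericPair γ δ) (hP : SiteConditions n P)
    {g : ℕ} (hl : P g) (hg : ¬ P (g + 1)) (hr : P (g + 2)) :
    ∃ X Y, IsTransferSolution n γ δ P X Y ∧ IsSeen γ X Y g ∧ IsSeen γ X Y (g + 2) ∧
      (∀ j, j + 1 = g → P j → IsSeen γ X Y j) ∧ (P (g + 3) → IsSeen γ X Y (g + 3)) := by
  have hn := hP.lt _ hr
  obtain ⟨X₁, Y₁, hX₁, hY₁, h0, hs₁, hseen₁, hseen₁'⟩ := exists_left_completion hγ hP.lt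
    (fun i h h' h'' => (hP.single i h h' h'').1) g (by omega) hg hl 1 one_ne_zero
  obtain ⟨X₂, Y₂, hX₂, hY₂, hn0, hs₂, hseen₂, hseen₂'⟩ := exists_right_completion hγ hP.lt
    (fun i h h' h'' => (hP.single i h h' h'').2) (g + 1) hg hr 1 one_ne_zero
  have L : ∀ (Z W : ℕ → ℂ) (m : ℕ), m ≤ g + 1 → (if m ≤ g + 1 then Z m else W m) = Z m :=
    fun Z W m h => if_pos h
  have R : ∀ (Z W : ℕ → ℂ) (m : ℕ), g + 2 ≤ m → (if m ≤ g + 1 then Z m else W m) = W m :=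
    fun Z W m h => if_neg (by omega)
  refine ⟨fun m => if m ≤ g + 1 then X₁ m else X₂ m, fun m => if m ≤ g + 1 then Y₁ m else Y₂ m,
    ⟨?_, ?_, ?_⟩, ?_, ?_, ?_, ?_⟩
  · simpa using h0
  · rw [R _ _ _ (by omega), hn0]
  · intro i hi
    unfold TransferAt
    obtain hi' | rfl | hi' : i ≤ g ∨ i = g + 1 ∨ g + 1 < i := by omega
    · simp only [L _ _ i (by omega), L _ _ (i + 1) (by omega)]
      exact hs₁ i hi'
    · simp [hX₁, hX₂, hY₁, hY₂]
    · simp only [R _ _ i (by omega), R _ _ (i + 1) (by omega)]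
      exact hs₂ i hi' hi
  · left
    simp only [L _ _ g (by omega), L _ _ (g + 1) le_rfl]
    exact hseen₁
  · left
    simp only [R _ _ (g + 2) le_rfl, R _ _ (g + 2 + 1) (by omega)]
    exact hseen₂
  · intro j hj hPj
    left
    simp only [L _ _ j (by omega), L _ _ (j + 1) (by omega)]
    exact hseen₁' j hj hPj
  · intro h
    left
    simp only [R _ _ (g + 3) (by omega), R _ _ (g + 3 + 1) (by omega)]
    exact hseen₂' h

/-- Three consecutive sites carry a solution of their own. -/
theorem exists_transferSolution_triple (hγ : IsGenericPair γ δ) {i : ℕ} (h₀ : P i)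
    (h₁ : P (i + 1)) (h₂ : P (i + 2)) (hn : i + 2 < n) :
    ∃ X Y, IsTransferSolution n γ δ P X Y ∧ IsSeen γ X Y i ∧ IsSeen γ X Y (i + 1) ∧
      IsSeen γ X Y (i + 2) := by
  refine ⟨fun m => if m = i + 1 then δ else if m = i + 2 then -1 else 0,
    fun m => if m = i + 1 then -1 else if m = i + 2 then γ else 0, ⟨?_, ?_, ?_⟩, ?_, ?_, ?_⟩
  · simp
  · rw [if_neg (by omega), if_neg (by omega)]
  · intro j hj
    obtain rfl | rfl | rfl | ⟨a, b, c⟩ :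
      j = i ∨ j = i + 1 ∨ j = i + 2 ∨ (j ≠ i ∧ j ≠ i + 1 ∧ j ≠ i + 2) := by omega
    · exact ⟨by simp, fun h => absurd h₀ h⟩
    · exact ⟨by simp; ring, fun h => absurd h₁ h⟩
    · exact ⟨by simp, fun h => absurd h₂ h⟩
    · simp [TransferAt, a, b, c]
  · left
    simpa using hγ.right_ne
  · left
    simp only [if_true, if_neg (show i + 1 + 1 ≠ i + 1 by omega)]
    exact fun h => hγ.one_add (by linear_combination -h)
  · left
    simpa using hγ.left_ne

theorem exists_transferSolution_left_pair (hγ : IsGenericPair γ δ) (h₀ : P 0) (h₁ : P 1)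
    (hn : 1 < n) :
    ∃ X Y, IsTransferSolution n γ δ P X Y ∧ IsSeen γ X Y 0 ∧ IsSeen γ X Y 1 := by
  refine ⟨fun m => if m = 1 then 1 else 0,
    fun m => if m = 0 then 1 - γ * δ else if m = 1 then -γ else 0, ⟨?_, ?_, ?_⟩, ?_, ?_⟩
  · simp
  · rw [if_neg (by omega), if_neg (by omega)]
  · intro j hj
    obtain rfl | rfl | ⟨a, b⟩ : j = 0 ∨ j = 1 ∨ (j ≠ 0 ∧ j ≠ 1) := by omega
    · exact ⟨by simp; ring, fun h => absurd h₀ h⟩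
    · exact ⟨by simp, fun h => absurd h₁ h⟩
    · simp [TransferAt, a, b]
  · left
    simp
  · left
    simpa using hγ.left_ne.symm

theorem exists_transferSolution_right_pair (hγ : IsGenericPair γ δ) {p : ℕ} (h₀ : P p)
    (h₁ : P (p + 1)) (hn : p + 2 = n) :
    ∃ X Y, IsTransferSolution n γ δ P X Y ∧ IsSeen γ X Y p ∧ IsSeen γ X Y (p + 1) := by
  refine ⟨fun m => if m = p + 1 then -δ else if m = p + 2 then 1 - γ * δ else 0,
    fun m => if m = p + 1 then 1 else 0, ⟨?_, ?_, ?_⟩, ?_, ?_⟩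
  · simp
  · rw [if_neg (by omega)]
  · intro j hj
    obtain rfl | rfl | hjp : j = p ∨ j = p + 1 ∨ j < p := by omega
    · exact ⟨by simp, fun h => absurd h₀ h⟩
    · exact ⟨by simp, fun h => absurd h₁ h⟩
    · have a₁ : j ≠ p := by omega
      have a₂ : j ≠ p + 1 := by omega
      have a₃ : j ≠ p + 2 := by omega
      simp [TransferAt, a₁, a₂, a₃]
  · left
    simpa using hγ.right_ne
  · left
    simp only [if_true, if_neg (show p + 1 + 1 ≠ p + 1 by omega)]
    intro h
    have : (1 : ℂ) = 0 := by linear_combination h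
    exact one_ne_zero this

theorem SiteConditions.exists_seen (hγ : IsGenericPair γ δ) (hP : SiteConditions n P) (hn : 2 ≤ n)
    {k : ℕ} (hk : P k) : ∃ X Y, IsTransferSolution n γ δ P X Y ∧ IsSeen γ X Y k := by
  -- Two neighbouring sites of a component can be seen at once.
  have hpair : ∀ p, P p → P (p + 1) → ∃ X Y, IsTransferSolution n γ δ P X Y ∧
      IsSeen γ X Y p ∧ IsSeen γ X Y (p + 1) := by
    intro p h₀ h₁
    by_cases h₂ : P (p + 2)
    · obtain ⟨X, Y, h, h', h'', -⟩ := exists_transferSolution_triple hγ h₀ h₁ h₂ (hP.lt _ h₂)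
      exact ⟨X, Y, h, h', h''⟩
    by_cases hl : ∃ j, j + 1 = p ∧ P j
    · obtain ⟨j, rfl, hj⟩ := hl
      obtain ⟨X, Y, h, -, h', h''⟩ := exists_transferSolution_triple hγ hj h₀ h₁ (hP.lt _ h₁)
      exact ⟨X, Y, h, h', h''⟩
    push Not at hl
    obtain rfl | h | ⟨j, rfl, hj⟩ | h := hP.pair p h₀ h₁ hl h₂
    · exact exists_transferSolution_left_pair hγ h₀ h₁ (by omega)
    · exact exists_transferSolution_right_pair hγ h₀ h₁ h
    · obtain ⟨X, Y, h, -, h', -, h''⟩ :=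
        exists_transferSolution_through_gap hγ hP hj (hl (j + 1) rfl) h₀
      exact ⟨X, Y, h, h', h'' h₁⟩
    · obtain ⟨X, Y, h', h'', -, h''', -⟩ :=
        exists_transferSolution_through_gap hγ hP h₁ h₂ h
      exact ⟨X, Y, h', h''' p rfl h₀, h''⟩
  by_cases hr : P (k + 1)
  · obtain ⟨X, Y, h, h', -⟩ := hpair k hk hr
    exact ⟨X, Y, h, h'⟩
  by_cases hl : ∃ j, j + 1 = k ∧ P j
  · obtain ⟨j, rfl, hj⟩ := hl
    obtain ⟨X, Y, h, -, h'⟩ := hpair j hj hk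
    exact ⟨X, Y, h, h'⟩
  push Not at hl
  obtain ⟨rfl | ⟨j, rfl, hj⟩, hr'⟩ := hP.single k hk hl hr
  · obtain ⟨X, Y, h, h', -⟩ := exists_transferSolution_through_gap hγ hP hk hr
      (hr'.resolve_left (by omega))
    exact ⟨X, Y, h, h'⟩
  · obtain ⟨X, Y, h, -, h', -⟩ :=
      exists_transferSolution_through_gap hγ hP hj (hl (j + 1) rfl) hk
    exact ⟨X, Y, h, h'⟩

/-! ### Necessity of the conditions -/

theorem IsTransferSolution.gap {X Y : ℕ → ℂ} (h : IsTransferSolution n γ δ P X Y) {g : ℕ}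
    (hgn : g < n) (hg : ¬ P g) :
    X (g + 1) = γ * X g ∧ Y g = δ * Y (g + 1) ∧ X g = Y (g + 1) := by
  obtain ⟨h₁, h₂⟩ := h.site g hgn
  obtain ⟨h₃, h₄⟩ := h₂ hg
  rw [h₃, sub_self] at h₁
  exact ⟨h₃, sub_eq_zero.mp h₁.symm, h₄⟩

theorem IsTransferSolution.gap_two (hγ : IsGenericPair γ δ) {X Y : ℕ → ℂ}
    (h : IsTransferSolution n γ δ P X Y) {g : ℕ} (hgn : g + 1 < n) (hg : ¬ P g)
    (hg' : ¬ P (g + 1)) : X g = 0 ∧ X (g + 1) = 0 := by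
  obtain ⟨h₁, -, h₃⟩ := h.gap (by omega) hg
  obtain ⟨-, h₂', h₃'⟩ := h.gap hgn hg'
  have h0 : X (g + 1) = 0 := (mul_eq_zero.mp (show (1 - γ * δ) * X (g + 1) = 0 by
    linear_combination h₁ + γ * h₃ + γ * h₂' - γ * δ * h₃')).resolve_left hγ.one_sub
  exact ⟨(mul_eq_zero.mp (h₁.symm.trans h0)).resolve_left hγ.left_ne, h0⟩

/-- Nothing leaves a gap to the right if the gap has more than one site or reaches the left end. -/
theorem IsTransferSolution.eq_zero_of_gap_left (hγ : IsGenericPair γ δ) {X Y : ℕ → ℂ}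
    (h : IsTransferSolution n γ δ P X Y) {i : ℕ} (hi : i < n) (h₁ : ∀ j, j + 1 = i → ¬ P j)
    (h₂ : ∀ j, j + 2 = i → ¬ P j) : X i = 0 ∧ (i ≠ 0 → Y i = 0) := by
  obtain rfl | rfl | ⟨j, rfl⟩ : i = 0 ∨ i = 1 ∨ ∃ j, i = j + 2 := by
    rcases i with _ | _ | j <;> simp
  · exact ⟨h.left, fun h => absurd rfl h⟩
  · obtain ⟨e₁, -, e₃⟩ := h.gap (g := 0) (by omega) (h₁ 0 rfl)
    rw [h.left] at e₁ e₃
    exact ⟨by simpa using e₁, fun _ => e₃.symm⟩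
  · obtain ⟨-, e⟩ := h.gap_two hγ (g := j) (by omega) (h₂ j rfl) (h₁ (j + 1) rfl)
    obtain ⟨e₁, -, e₃⟩ := h.gap (g := j + 1) (by omega) (h₁ (j + 1) rfl)
    rw [e] at e₁ e₃
    exact ⟨by simpa using e₁, fun _ => e₃.symm⟩

/-- Nothing leaves a gap to the left if the gap has more than one site or reaches the right end. -/
theorem IsTransferSolution.eq_zero_of_gap_right (hγ : IsGenericPair γ δ) {X Y : ℕ → ℂ}
    (h : IsTransferSolution n γ δ P X Y) {i : ℕ} (hi : i < n) (h₁ : ¬ P (i + 1))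
    (h₂ : ¬ P (i + 2)) : Y (i + 1) = 0 ∧ (i + 1 ≠ n → X (i + 1) = 0) := by
  obtain rfl | hn | hn : i + 1 = n ∨ i + 2 = n ∨ i + 2 < n := by omega
  · exact ⟨h.right, fun h => absurd rfl h⟩
  · obtain ⟨-, e₂, e₃⟩ := h.gap (g := i + 1) (by omega) h₁
    have e : Y (i + 1 + 1) = 0 := hn ▸ h.right
    rw [e] at e₂ e₃
    exact ⟨by simpa using e₂, fun _ => e₃⟩
  · obtain ⟨e, -⟩ := h.gap_two hγ (g := i + 1) (by omega) h₁ h₂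
    obtain ⟨-, e₂, e₃⟩ := h.gap (g := i + 1) (by omega) h₁
    rw [← e₃, e, mul_zero] at e₂
    exact ⟨e₂, fun _ => e⟩

theorem not_isSeen {X Y : ℕ → ℂ} {i : ℕ} (h : TransferAt γ δ P X Y i)
    (hX : X i = 0) (hY : Y (i + 1) = 0) (hYi : Y i = 0) : ¬ IsSeen γ X Y i := by
  have := h.1
  rw [hY, hYi, mul_zero, sub_zero] at this
  rintro (h' | h')
  · exact h' (sub_eq_zero.mp this)
  · exact h' (hX.trans hY.symm)

theorem siteConditions_of_exists_seen (hγ : IsGenericPair γ δ) (hlt : ∀ i, P i → i < n)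
    (hseen : ∀ k, P k → ∃ X Y, IsTransferSolution n γ δ P X Y ∧ IsSeen γ X Y k) :
    SiteConditions n P where
  lt := hlt
  single i hi hl hr := by
    have hin := hlt i hi
    obtain ⟨X, Y, h, hs⟩ := hseen i hi
    have hsite := h.site i hin
    constructor
    · by_contra! hcon
      obtain ⟨h0, hcon⟩ := hcon
      obtain ⟨hX, hY⟩ := h.eq_zero_of_gap_left hγ hin hl hcon
      have hYi := hY h0
      refine not_isSeen hsite hX ?_ hYi hs
      by_cases hn : i + 1 = n
      · exact hn ▸ h.right
      · obtain ⟨-, e₂, e₃⟩ := h.gap (g := i + 1) (by omega) hr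
        have e : Y (i + 1 + 1) = 0 := (mul_eq_zero.mp (show (1 + δ ^ 2) * Y (i + 1 + 1) = 0 by
          linear_combination hsite.1 + hYi + γ * hX - e₃ - δ * e₂)).resolve_left hγ.right_sq
        rw [e₂, e, mul_zero]
    · by_contra! hcon
      obtain ⟨hn, hcon⟩ := hcon
      obtain ⟨hY, hX⟩ := h.eq_zero_of_gap_right hγ hin hr hcon
      have hXi := hX hn
      have key : X i = 0 ∧ Y i = 0 := by
        have e := hsite.1
        rw [hXi, hY, mul_zero, sub_zero, zero_sub] at e
        obtain rfl | ⟨j, rfl⟩ : i = 0 ∨ ∃ j, i = j + 1 := by rcases i with _ | j <;> simp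
        · rw [h.left] at e
          exact ⟨h.left, by simpa using e.symm⟩
        · obtain ⟨e₁, -, e₃⟩ := h.gap (g := j) (by omega) (hl j rfl)
          have e0 : X j = 0 := (mul_eq_zero.mp (show (1 + γ ^ 2) * X j = 0 by
            linear_combination e₃ - e - γ * e₁)).resolve_left hγ.left_sq
          exact ⟨by rw [e₁, e0, mul_zero], by rw [← e₃, e0]⟩
      exact not_isSeen hsite key.1 hY key.2 hs
  pair p h₀ h₁ hl hr := by
    by_contra! hcon
    obtain ⟨hp, hn, hl', hr'⟩ := hcon
    have hpn := hlt _ h₁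
    obtain ⟨X, Y, h, hs⟩ := hseen p h₀
    obtain ⟨hX, hY⟩ := h.eq_zero_of_gap_left hγ (by omega) hl hl'
    obtain ⟨hY', hX'⟩ := h.eq_zero_of_gap_right hγ hpn hr hr'
    have e₁ := (h.site p (by omega)).1
    have e₂ := (h.site (p + 1) hpn).1
    have hYp := hY hp
    have hXp := hX' hn
    have e : Y (p + 1) = 0 := (mul_eq_zero.mp (show (1 - γ * δ) * Y (p + 1) = 0 by
      linear_combination -e₂ - γ * e₁ + hXp + δ * hY' - γ * hYp - γ ^ 2 * hX)).resolve_left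
        hγ.one_sub
    exact not_isSeen (h.site p (by omega)) hX e hYp hs

end

/-! ### The reduced metric as a transfer problem -/

section farMetric

variable {n : ℕ}

/-- The set of sites of the chain as a set of natural numbers. -/
def sitePred (A : Finset (Fin n)) (i : ℕ) : Prop := ∃ h : i < n, (⟨i, h⟩ : Fin n) ∈ A

/-- `∑_{j < m} γ ^ (m - 1 - j) vⱼ`. -/
noncomputable def leftSum (γ : ℂ) (v : Fin n → ℂ) (m : ℕ) : ℂ :=
  ∑ j : Fin n, if j.val < m then γ ^ (m - j.val - 1) * v j else 0

/-- `∑_{j ≥ m} δ ^ (j - m) vⱼ`. -/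
noncomputable def rightSum (δ : ℂ) (v : Fin n → ℂ) (m : ℕ) : ℂ :=
  ∑ j : Fin n, if m ≤ j.val then δ ^ (j.val - m) * v j else 0

theorem leftSum_zero (γ : ℂ) (v : Fin n → ℂ) : leftSum γ v 0 = 0 := by simp [leftSum]

theorem rightSum_last (δ : ℂ) (v : Fin n → ℂ) : rightSum δ v n = 0 :=
  Finset.sum_eq_zero fun j _ => if_neg (by omega)

theorem leftSum_succ (γ : ℂ) (v : Fin n → ℂ) (i : Fin n) :
    leftSum γ v (i + 1) = γ * leftSum γ v i + v i := by
  have ev : v i = ∑ j, if j = i then v j else 0 := by simp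
  rw [leftSum, leftSum, Finset.mul_sum, ev,
    ← Finset.sum_add_distrib]
  refine Finset.sum_congr rfl fun j _ => ?_
  rcases lt_trichotomy j i with h | rfl | h
  · have h' : j.val < i.val := h
    rw [if_pos (by omega), if_pos h', if_neg h.ne, add_zero, ← mul_assoc, ← pow_succ',
      show i.val + 1 - j.val - 1 = i.val - j.val - 1 + 1 by omega]
  · simp
  · have h' : i.val < j.val := h
    rw [if_neg (by omega), if_neg (by omega), if_neg h.ne']
    simp

theorem rightSum_eq (δ : ℂ) (v : Fin n → ℂ) (i : Fin n) :
    rightSum δ v i = δ * rightSum δ v (i + 1) + v i := by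
  have ev : v i = ∑ j, if j = i then v j else 0 := by simp
  rw [rightSum, rightSum, Finset.mul_sum, ev,
    ← Finset.sum_add_distrib]
  refine Finset.sum_congr rfl fun j _ => ?_
  rcases lt_trichotomy j i with h | rfl | h
  · have h' : j.val < i.val := h
    rw [if_neg (by omega), if_neg (by omega), if_neg h.ne]
    simp
  · simp
  · have h' : i.val < j.val := h
    rw [if_pos (by omega), if_pos (by omega), if_neg h.ne', add_zero, ← mul_assoc, ← pow_succ',
      show j.val - i.val = j.val - (i.val + 1) + 1 by omega]

theorem farMetric_mulVec (γ : ℂ) (v : Fin n → ℂ) (i : Fin n) :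
    (farMetric n γ *ᵥ v) i = v i + Complex.I * γ.im *
      (leftSum γ v i - rightSum (starRingEnd ℂ γ) v (i + 1)) := by
  have ev : v i = ∑ j, if j = i then v j else 0 := by simp
  rw [mulVec, dotProduct, leftSum, rightSum, ← Finset.sum_sub_distrib, Finset.mul_sum,
    ev, ← Finset.sum_add_distrib]
  refine Finset.sum_congr rfl fun j _ => ?_
  rcases lt_trichotomy j i with h | rfl | h
  · have h' : j.val < i.val := h
    simp only [farMetric, of_apply]
    rw [if_neg h.ne', if_neg h.not_gt, if_neg h.ne, if_pos h', if_neg (by omega)]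
    ring
  · simp [farMetric]
  · have h' : i.val < j.val := h
    simp only [farMetric, of_apply]
    rw [if_neg h.ne, if_pos h, if_neg h.ne', if_neg (by omega), if_pos (by omega),
      show j.val - (i.val + 1) = j.val - i.val - 1 by omega]
    ring

/-- A solution of the transfer equations is determined by its source. -/
theorem IsTransferSolution.eq_sums {γ δ : ℂ} {P : ℕ → Prop} {X Y : ℕ → ℂ}
    (h : IsTransferSolution n γ δ P X Y) {v : Fin n → ℂ}
    (hv : ∀ i : Fin n, v i = X (i + 1) - γ * X i) :
    ∀ m ≤ n, X m = leftSum γ v m ∧ Y m = rightSum δ v m := by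
  have hX : ∀ m ≤ n, X m = leftSum γ v m := by
    intro m hm
    induction m with
    | zero => rw [h.left, leftSum_zero]
    | succ m ih =>
      have := leftSum_succ γ v ⟨m, hm⟩
      simp only [hv ⟨m, hm⟩] at this
      rw [this, ← ih (by omega)]; ring
  have hY : ∀ m ≤ n, Y m = rightSum δ v m := by
    intro m hm
    induction hm using Nat.decreasingInduction with
    | self => rw [h.right, rightSum_last]
    | of_succ m hm ih =>
      have := rightSum_eq δ v ⟨m, hm⟩
      simp only [hv ⟨m, hm⟩, (h.site m hm).1] at this
      rw [this, ← ih]; ring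
  exact fun m hm => ⟨hX m hm, hY m hm⟩

theorem exists_mem_biSupported_iff {γ : ℂ} (him : γ.im ≠ 0) (A : Finset (Fin n)) (k : Fin n) :
    (∃ v ∈ biSupported (farMetric n γ) A, v k ≠ 0 ∨ (farMetric n γ *ᵥ v) k ≠ 0) ↔
      ∃ X Y, IsTransferSolution n γ (starRingEnd ℂ γ) (sitePred A) X Y ∧ IsSeen γ X Y k := by
  have hI : Complex.I * (γ.im : ℂ) ≠ 0 := by simpa using him
  constructor
  · rintro ⟨v, hv, hk⟩
    have e : ∀ i : Fin n, leftSum γ v (i + 1) - γ * leftSum γ v i = v i := fun i => by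
      rw [leftSum_succ]; ring
    refine ⟨leftSum γ v, rightSum (starRingEnd ℂ γ) v, ⟨leftSum_zero _ _, rightSum_last _ _, ?_⟩,
      ?_⟩
    · intro i hi
      refine ⟨?_, fun hA => ?_⟩
      · rw [leftSum_succ γ v ⟨i, hi⟩, rightSum_eq _ v ⟨i, hi⟩]; ring
      · obtain ⟨h₁, h₂⟩ := hv ⟨i, hi⟩ fun h => hA ⟨hi, h⟩
        rw [farMetric_mulVec, h₁, zero_add] at h₂
        refine ⟨?_, sub_eq_zero.mp ((mul_eq_zero.mp h₂).resolve_left hI)⟩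
        rw [leftSum_succ γ v ⟨i, hi⟩, h₁, add_zero]
    · by_contra hns
      simp only [IsSeen, not_or, not_not] at hns
      have h0 : v k = 0 := by rw [← e k, hns.1, sub_self]
      rw [farMetric_mulVec, hns.2, h0] at hk
      simp at hk
  · rintro ⟨X, Y, h, hs⟩
    let v : Fin n → ℂ := fun i => X (i + 1) - γ * X i
    have hsum := h.eq_sums (v := v) fun i => rfl
    have hMv : ∀ i : Fin n, (farMetric n γ *ᵥ v) i =
        v i + Complex.I * γ.im * (X i - Y (i + 1)) := fun i => by
      rw [farMetric_mulVec, (hsum i (by omega)).1, (hsum (i + 1) (by omega)).2]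
    refine ⟨v, fun i hi => ?_, ?_⟩
    · obtain ⟨h₁, h₂⟩ := (h.site i i.2).2 fun ⟨_, h⟩ => hi h
      have h0 : v i = 0 := sub_eq_zero.mpr h₁
      exact ⟨h0, by rw [hMv, h0, h₂]; simp⟩
    · by_cases h0 : v k = 0
      · right
        rw [hMv, h0, zero_add]
        exact mul_ne_zero hI (sub_ne_zero.mpr (hs.resolve_left fun h' => h' (sub_eq_zero.mp h0)))
      · exact Or.inl h0

end farMetric

/-! ### Components of the site graph -/

section graph

variable {n : ℕ} {A : Finset (Fin n)}

theorem exists_isComponent_mem {i : Fin n} (hi : i ∈ A) : ∃ C, IsComponent A C ∧ i ∈ C := by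
  classical
  let c := (siteGraph A).connectedComponentMk ⟨i, hi⟩
  refine ⟨Finset.univ.filter fun j => j ∈ Subtype.val '' c.supp, ⟨c, by
    ext; simp only [Finset.coe_filter, Finset.mem_univ, true_and, Set.mem_ofPred_eq]⟩, ?_⟩
  simp [c, hi]

theorem IsComponent.subset {C : Finset (Fin n)} (h : IsComponent A C) : C ⊆ A := by
  obtain ⟨c, hc⟩ := h
  intro i hi
  rw [← Finset.mem_coe, hc] at hi
  obtain ⟨x, -, rfl⟩ := hi
  exact x.2

theorem IsComponent.nonempty {C : Finset (Fin n)} (h : IsComponent A C) : C.Nonempty := by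
  obtain ⟨c, hc⟩ := h
  rw [← Finset.coe_nonempty, hc]
  exact c.nonempty_supp.image _

theorem IsComponent.eq_of_mem {C D : Finset (Fin n)} (hC : IsComponent A C)
    (hD : IsComponent A D) {i : Fin n} (hi : i ∈ C) (hi' : i ∈ D) : C = D := by
  obtain ⟨c, hc⟩ := hC
  obtain ⟨d, hd⟩ := hD
  rw [← Finset.mem_coe, hc] at hi
  rw [← Finset.mem_coe, hd] at hi'
  obtain ⟨x, hx, rfl⟩ := hi
  obtain ⟨y, hy, hyx⟩ := hi'
  obtain rfl := Subtype.ext hyx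
  rw [SimpleGraph.ConnectedComponent.mem_supp_iff] at hx hy
  rw [← Finset.coe_inj, hc, hd, ← hx, ← hy]

theorem IsComponent.mem_of_adj {C : Finset (Fin n)} (h : IsComponent A C) {i j : Fin n}
    (hi : i ∈ C) (hj : j ∈ A) (hij : i.val + 1 = j.val ∨ j.val + 1 = i.val) : j ∈ C := by
  obtain ⟨c, hc⟩ := h
  rw [← Finset.mem_coe, hc] at hi ⊢
  obtain ⟨x, hx, rfl⟩ := hi
  refine ⟨⟨j, hj⟩, c.mem_supp_of_adj_mem_supp hx ?_, rfl⟩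
  simpa [siteGraph, SimpleGraph.pathGraph_adj] using hij

/-- A component that meets a set that is closed under passing to neighbours in `A` is contained in
it. -/
theorem IsComponent.subset_of_closed {C S : Finset (Fin n)} (h : IsComponent A C) {i : Fin n}
    (hi : i ∈ C) (hiS : i ∈ S)
    (hS : ∀ k ∈ S, ∀ j ∈ A, (k.val + 1 = j.val ∨ j.val + 1 = k.val) → j ∈ S) : C ⊆ S := by
  obtain ⟨c, hc⟩ := h
  intro j hj
  rw [← Finset.mem_coe, hc] at hi hj
  obtain ⟨x, hx, rfl⟩ := hi
  obtain ⟨y, hy, rfl⟩ := hj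
  obtain ⟨w⟩ := c.reachable_of_mem_supp hx hy
  clear hx hy
  induction w with
  | nil => exact hiS
  | cons hadj _ ih =>
    refine ih (hS _ hiS _ (Subtype.coe_prop _) ?_)
    simpa [siteGraph, SimpleGraph.pathGraph_adj] using hadj

theorem isComponent_singleton_iff {i : Fin n} : IsComponent A {i} ↔
    i ∈ A ∧ ∀ j ∈ A, ¬ (i.val + 1 = j.val ∨ j.val + 1 = i.val) := by
  constructor
  · refine fun h => ⟨h.subset (by simp), fun j hj hij => ?_⟩
    have := h.mem_of_adj (by simp) hj hij
    rw [Finset.mem_singleton] at this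
    subst this; omega
  · rintro ⟨hi, h⟩
    obtain ⟨C, hC, hiC⟩ := exists_isComponent_mem hi
    have : C ⊆ {i} := hC.subset_of_closed hiC (by simp) fun k hk j hj hkj => by
      obtain rfl := Finset.mem_singleton.mp hk
      exact absurd hkj (h j hj)
    rwa [Finset.Subset.antisymm this (by simpa using hiC)] at hC

theorem isComponent_pair_iff {i j : Fin n} (hij : i.val + 1 = j.val) : IsComponent A {i, j} ↔
    i ∈ A ∧ j ∈ A ∧ (∀ k ∈ A, k.val + 1 ≠ i.val ∧ j.val + 1 ≠ k.val) := by
  constructor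
  · refine fun h => ⟨h.subset (by simp), h.subset (by simp), fun k hk => ⟨fun hki => ?_,
      fun hjk => ?_⟩⟩
    · have := h.mem_of_adj (i := i) (by simp) hk (Or.inr hki)
      rw [Finset.mem_insert, Finset.mem_singleton] at this
      rcases this with rfl | rfl <;> omega
    · have := h.mem_of_adj (i := j) (by simp) hk (Or.inl hjk)
      rw [Finset.mem_insert, Finset.mem_singleton] at this
      rcases this with rfl | rfl <;> omega
  · rintro ⟨hi, hj, h⟩
    obtain ⟨C, hC, hiC⟩ := exists_isComponent_mem hi
    have hjC := hC.mem_of_adj hiC hj (Or.inl hij)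
    have : C ⊆ {i, j} := hC.subset_of_closed hiC (by simp) fun k hk l hl hkl => by
      rw [Finset.mem_insert, Finset.mem_singleton] at hk ⊢
      have := h l hl
      rcases hk with rfl | rfl
      · right; ext; omega
      · left; ext; omega
    rwa [Finset.Subset.antisymm this (by simp [Finset.insert_subset_iff, hiC, hjC])] at hC

theorem IsComponent.eq_pair {C : Finset (Fin n)} (h : IsComponent A C) (hC : C.card = 2) :
    ∃ i j : Fin n, i.val + 1 = j.val ∧ C = {i, j} := by
  obtain ⟨x, y, hxy, rfl⟩ := Finset.card_eq_two.mp hC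
  by_cases h₁ : x.val + 1 = y.val
  · exact ⟨x, y, h₁, rfl⟩
  by_cases h₂ : y.val + 1 = x.val
  · exact ⟨y, x, h₂, Finset.pair_comm x y⟩
  have : ({x, y} : Finset (Fin n)) ⊆ {x} :=
    h.subset_of_closed (by simp) (Finset.mem_singleton_self x) fun k hk j hj hkj => by
      obtain rfl := Finset.mem_singleton.mp hk
      have := h.mem_of_adj (by simp) hj hkj
      rw [Finset.mem_insert, Finset.mem_singleton] at this
      rcases this with rfl | rfl
      · simp
      · omega
  exact absurd (this (by simp : y ∈ _)) (by simpa using hxy.symm)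

theorem le_add_length_of_walk {i j : Fin n} (w : (SimpleGraph.pathGraph n).Walk i j) :
    i.val ≤ j.val + w.length ∧ j.val ≤ i.val + w.length := by
  induction w with
  | nil => simp
  | cons h w ih =>
    rw [SimpleGraph.pathGraph_adj] at h
    rw [SimpleGraph.Walk.length_cons]
    omega

/-- Two different components are never at distance one, and at distance at most two exactly if a
site of one is two steps away from a site of the other. -/
theorem siteDist_le_two_iff {C D : Finset (Fin n)} (hC : IsComponent A C) (hD : IsComponent A D)
    (hCD : D ≠ C) : siteDist C D ≤ 2 ↔ ∃ i ∈ C, ∃ j ∈ D, i.val + 2 = j.val ∨ j.val + 2 = i.val := by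
  constructor
  · intro h
    obtain ⟨x, hx⟩ := hC.nonempty
    obtain ⟨y, hy⟩ := hD.nonempty
    obtain ⟨i, hi, j, hj, hij⟩ := Nat.sInf_mem (⟨_, x, hx, y, hy, rfl⟩ :
      {d | ∃ i ∈ C, ∃ j ∈ D, d = (SimpleGraph.pathGraph n).dist i j}.Nonempty)
    obtain ⟨w, hw⟩ := (SimpleGraph.pathGraph_preconnected n i j).exists_walk_length_eq_dist
    have hd : siteDist C D = w.length := hij.trans hw.symm
    have hle := le_add_length_of_walk w
    refine ⟨i, hi, j, hj, ?_⟩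
    have hne : j ∉ C := fun h => hCD (hD.eq_of_mem hC hj h)
    have h₁ : i.val ≠ j.val := fun e => hne (Fin.ext e ▸ hi)
    have h₂ : ¬ (i.val + 1 = j.val ∨ j.val + 1 = i.val) := fun e =>
      hne (hC.mem_of_adj hi (hD.subset hj) e)
    omega
  · rintro ⟨i, hi, j, hj, hij⟩
    have key : ∀ a b : Fin n, a.val + 2 = b.val → (SimpleGraph.pathGraph n).dist a b ≤ 2 := by
      intro a b hab
      let m : Fin n := ⟨a.val + 1, by omega⟩
      have h₁ : (SimpleGraph.pathGraph n).Adj a m := by simp [SimpleGraph.pathGraph_adj, m]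
      have h₂ : (SimpleGraph.pathGraph n).Adj m b := by
        simp [SimpleGraph.pathGraph_adj, m]; omega
      exact SimpleGraph.dist_le (.cons h₁ (.cons h₂ .nil))
    have hle : siteDist C D ≤ (SimpleGraph.pathGraph n).dist i j :=
      Nat.sInf_le ⟨i, hi, j, hj, rfl⟩
    refine hle.trans ?_
    rcases hij with h | h
    · exact key i j h
    · rw [SimpleGraph.dist_comm]
      exact key j i h

theorem isEndPair_pair_iff {i j : Fin n} (hij : i.val + 1 = j.val) :
    IsEndPair {i, j} ↔ i.val = 0 ∨ i.val + 2 = n := by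
  have hl : labels {i, j} = {i.val + 1, i.val + 2} := by
    simp [labels, Finset.image_insert, ← hij]
  have key : ∀ a b : ℕ, ({a, a + 1} : Finset ℕ) = {b, b + 1} ↔ a = b := by
    refine fun a b => ⟨fun h => ?_, fun h => by rw [h]⟩
    have h₁ : a ∈ ({b, b + 1} : Finset ℕ) := h ▸ by simp
    have h₂ : b ∈ ({a, a + 1} : Finset ℕ) := h ▸ by simp
    simp only [Finset.mem_insert, Finset.mem_singleton] at h₁ h₂
    omega
  obtain ⟨m, rfl⟩ : ∃ m, n = m + 1 := ⟨n - 1, by omega⟩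
  rw [IsEndPair, hl, show m + 1 - 1 = m by omega]
  refine or_congr ((key (i.val + 1) 1).trans ?_) ((key (i.val + 1) m).trans ?_) <;> omega

theorem mem_iff_sitePred {i : Fin n} : i ∈ A ↔ sitePred A i :=
  ⟨fun h => ⟨i.2, h⟩, fun ⟨_, h⟩ => h⟩

theorem isComponent_singleton_iff_sitePred {i : Fin n} : IsComponent A {i} ↔
    sitePred A i ∧ (∀ j, j + 1 = i.val → ¬ sitePred A j) ∧ ¬ sitePred A (i + 1) := by
  rw [isComponent_singleton_iff, mem_iff_sitePred]
  refine and_congr_right fun _ => ⟨fun h => ⟨fun _ hj ⟨_, hjA⟩ => h _ hjA (Or.inr hj),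
    fun ⟨_, hA⟩ => h _ hA (Or.inl rfl)⟩, fun ⟨h₁, h₂⟩ _ hj => ?_⟩
  rw [mem_iff_sitePred] at hj
  rintro (e | e)
  · exact h₂ (e ▸ hj)
  · exact h₁ _ e hj

theorem isComponent_pair_iff_sitePred {i j : Fin n} (hij : i.val + 1 = j.val) :
    IsComponent A {i, j} ↔ sitePred A i ∧ sitePred A (i + 1) ∧
      (∀ k, k + 1 = i.val → ¬ sitePred A k) ∧ ¬ sitePred A (i + 2) := by
  rw [isComponent_pair_iff hij, mem_iff_sitePred, mem_iff_sitePred, hij]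
  refine and_congr_right fun _ => and_congr_right fun _ =>
    ⟨fun h => ⟨fun k hk ⟨hk', hkA⟩ => (h _ hkA).1 hk, fun ⟨h', hA⟩ => (h _ hA).2 (by simp; omega)⟩,
      fun ⟨h₁, h₂⟩ k hk => ?_⟩
  rw [mem_iff_sitePred] at hk
  exact ⟨fun e => h₁ _ e hk, fun e => h₂ (by rwa [show i.val + 2 = k.val by omega])⟩

theorem SiteConditions.connectivityConditions (hn : 2 ≤ n) (h : SiteConditions n (sitePred A)) :
    ConnectivityConditions A := by
  have hpair : ∀ C, IsComponent A C → C.card = 2 → ¬ IsEndPair C →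
      ∃ C', IsComponent A C' ∧ C' ≠ C ∧ siteDist C C' ≤ 2 := by
    intro C hC hcard hend
    obtain ⟨i, j, hij, rfl⟩ := hC.eq_pair hcard
    rw [isEndPair_pair_iff hij] at hend
    obtain ⟨h₀, h₁, h₂, h₃⟩ := (isComponent_pair_iff_sitePred hij).mp hC
    have key : ∀ l : Fin n, l ∈ A → (l.val + 2 = i.val ∨ j.val + 2 = l.val) →
        ∃ C', IsComponent A C' ∧ C' ≠ {i, j} ∧ siteDist {i, j} C' ≤ 2 := by
      intro l hl hil
      obtain ⟨D, hD, hlD⟩ := exists_isComponent_mem hl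
      have hne : D ≠ {i, j} := by
        rintro rfl
        rw [Finset.mem_insert, Finset.mem_singleton] at hlD
        rcases hlD with rfl | rfl <;> omega
      refine ⟨D, hD, hne, (siteDist_le_two_iff hC hD hne).mpr ?_⟩
      rcases hil with e | e
      · exact ⟨i, by simp, l, hlD, Or.inr e⟩
      · exact ⟨j, by simp, l, hlD, Or.inl e⟩
    rcases h.pair i h₀ h₁ h₂ h₃ with e | e | ⟨l, hl, hl', hA⟩ | ⟨hl', hA⟩
    · exact absurd (Or.inl e) hend
    · exact absurd (Or.inr e) hend
    · exact key _ hA (Or.inl hl)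
    · exact key _ hA (Or.inr (by simp; omega))
  have hsingle : ∀ i : Fin n, IsComponent A {i} →
      (i.val = 0 ∨ ∃ j, j + 2 = i.val ∧ sitePred A j) ∧
        (i.val + 1 = n ∨ sitePred A (i.val + 2)) := by
    intro i hi
    obtain ⟨h₀, h₁, h₂⟩ := isComponent_singleton_iff_sitePred.mp hi
    exact h.single i h₀ h₁ h₂
  refine ⟨fun C hC hcard hend => ?_, fun i hi j hij => ?_, hpair, fun C hC hcard => ?_⟩
  · have hpos := hC.nonempty.card_pos
    obtain hc | hc : C.card = 1 ∨ C.card = 2 := by omega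
    · obtain ⟨i, rfl⟩ := Finset.card_eq_one.mp hc
      obtain ⟨j, hj, hjA⟩ : ∃ j : Fin n, j ≠ i ∧ j ∈ A := by
        obtain ⟨h₁ | ⟨j, hj, hj', hA⟩, h₂ | ⟨hj', hA⟩⟩ := hsingle i hC
        · omega
        · exact ⟨_, fun e => by simp [Fin.ext_iff] at e, hA⟩
        · exact ⟨_, fun e => by simp [Fin.ext_iff] at e; omega, hA⟩
        · exact ⟨_, fun e => by simp [Fin.ext_iff] at e, hA⟩
      obtain ⟨D, hD, hjD⟩ := exists_isComponent_mem hjA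
      exact ⟨D, hD, fun e => hj (by simpa [e] using hjD)⟩
    · obtain ⟨D, hD, hne, -⟩ := hpair C hC hc hend
      exact ⟨D, hD, hne⟩
  · obtain ⟨h₁, h₂⟩ := hsingle i hi
    rw [mem_iff_sitePred]
    rcases hij with e | e
    · obtain h₁ | ⟨l, hl, hA⟩ := h₁
      · omega
      · rwa [show j.val = l by omega]
    · rw [e]
      exact h₂.resolve_left (by omega)
  · obtain ⟨i, rfl⟩ := Finset.card_eq_one.mp hcard
    have hlab : ∀ m, i.val + 1 = m → labels {i} = {m} := fun m hm => by simp [labels, hm]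
    rcases hC with hL | hR
    · obtain ⟨hcomp, k, hk, hmin⟩ := id hL
      obtain rfl := Finset.mem_singleton.mp hk
      refine Or.inl ⟨hL, hlab _ ?_⟩
      obtain h₁ | ⟨l, hl, hl', hA⟩ := (hsingle k hcomp).1
      · omega
      · have := Fin.le_def.mp (hmin _ hA)
        simp at this; omega
    · obtain ⟨hcomp, k, hk, hmax⟩ := id hR
      obtain rfl := Finset.mem_singleton.mp hk
      refine Or.inr ⟨hR, hlab _ ?_⟩
      obtain h₁ | ⟨hl', hA⟩ := (hsingle k hcomp).2
      · exact h₁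
      · have := Fin.le_def.mp (hmax _ hA)
        simp at this

theorem ConnectivityConditions.siteConditions (hn : 2 ≤ n) (h : ConnectivityConditions A) :
    SiteConditions n (sitePred A) := by
  have hnotpair : ∀ i : Fin n, ¬ IsEndPair {i} := by
    intro i hi
    have hcard : (labels {i}).card = 1 := by simp [labels]
    rcases hi with e | e <;> rw [e, Finset.card_pair (by omega)] at hcard <;> omega
  refine ⟨fun i hi => hi.1, fun i hi hl hr => ?_, fun p h₀ h₁ hl hr => ?_⟩
  · have hin := hi.1
    have hC : IsComponent A {(⟨i, hin⟩ : Fin n)} :=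
      isComponent_singleton_iff_sitePred.mpr ⟨hi, hl, hr⟩
    -- By `single`, a site two steps away can be missing from `A` only if it lies outside the chain;
    -- then `{i}` is an edge component.
    obtain ⟨D, hD, hne⟩ := h.not_alone _ hC (by simp) (hnotpair _)
    have hlabel : ∀ m, labels {(⟨i, hin⟩ : Fin n)} = {m} → i + 1 = m := fun m hm => by
      simpa [labels] using hm
    have hsingle := h.single _ hC
    constructor
    · by_contra! hcon
      obtain ⟨h0, hcon⟩ := hcon
      obtain rfl : i = 1 := by
        by_contra h1
        refine hcon (i - 2) (by omega) ?_
        exact ⟨by omega, hsingle ⟨i - 2, by omega⟩ (Or.inl (by simp; omega))⟩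
      have hL : IsLeftmost A {(⟨1, hin⟩ : Fin n)} := by
        refine ⟨hC, _, Finset.mem_singleton_self _, fun j hj => ?_⟩
        rw [Fin.le_def]
        by_contra hj'
        simp only [not_le] at hj'
        rw [mem_iff_sitePred] at hj
        exact hl 0 rfl (by rwa [show j.val = 0 by omega] at hj)
      rcases h.edge _ (Or.inl hL) (by simp) with ⟨-, e⟩ | ⟨-, e⟩
      · have := hlabel _ e
        omega
      · -- A chain of two sites has no room for another component.
        have hn2 := hlabel _ e
        obtain ⟨x, hx⟩ := hD.nonempty
        have hxA := hD.subset hx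
        rw [mem_iff_sitePred] at hxA
        obtain hx0 | hx1 : x.val = 0 ∨ x.val = 1 := by omega
        · exact hl 0 rfl (hx0 ▸ hxA)
        · exact hne (hD.eq_of_mem hC hx (by simp [Fin.ext_iff, hx1]))
    · by_contra! hcon
      obtain ⟨h0, hcon⟩ := hcon
      have hi2 : i + 2 = n := by
        by_contra h1
        have hlt : i + 2 < n := by omega
        exact hcon ⟨hlt, hsingle ⟨i + 2, hlt⟩ (Or.inr rfl)⟩
      have hR : IsRightmost A {(⟨i, hin⟩ : Fin n)} := by
        refine ⟨hC, _, Finset.mem_singleton_self _, fun j hj => ?_⟩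
        rw [Fin.le_def]
        by_contra hj'
        simp only [not_le] at hj'
        rw [mem_iff_sitePred] at hj
        exact hr (by rwa [show j.val = i + 1 by omega] at hj)
      rcases h.edge _ (Or.inr hR) (by simp) with ⟨-, e⟩ | ⟨-, e⟩
      · have := hlabel _ e
        obtain rfl : i = 0 := by omega
        obtain ⟨x, hx⟩ := hD.nonempty
        have hxA := hD.subset hx
        rw [mem_iff_sitePred] at hxA
        obtain hx0 | hx1 : x.val = 0 ∨ x.val = 1 := by omega
        · exact hne (hD.eq_of_mem hC hx (by simp [Fin.ext_iff, hx0]))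
        · exact hr (by rwa [hx1] at hxA)
      · have := hlabel _ e
        omega
  · have hpn := h₁.1
    let i : Fin n := ⟨p, by omega⟩
    let j : Fin n := ⟨p + 1, hpn⟩
    have hij : i.val + 1 = j.val := rfl
    have hC : IsComponent A {i, j} := (isComponent_pair_iff_sitePred hij).mpr ⟨h₀, h₁, hl, hr⟩
    by_cases hend : IsEndPair {i, j}
    · rcases (isEndPair_pair_iff hij).mp hend with e | e
      · exact Or.inl e
      · exact Or.inr (Or.inl e)
    have hcard : ({i, j} : Finset (Fin n)).card = 2 :=
      Finset.card_pair (by simp [i, j])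
    obtain ⟨D, hD, hne, hdist⟩ := h.pair _ hC hcard hend
    obtain ⟨x, hx, y, hy, hxy⟩ := (siteDist_le_two_iff hC hD hne).mp hdist
    have hyA := mem_iff_sitePred.mp (hD.subset hy)
    rw [Finset.mem_insert, Finset.mem_singleton] at hx
    rcases hx with rfl | rfl
    · rcases hxy with e | e
      · exact absurd (by rwa [← e] at hyA) hr
      · exact Or.inr (Or.inr (Or.inl ⟨y, e, hyA⟩))
    · rcases hxy with e | e
      · exact Or.inr (Or.inr (Or.inr (by rwa [← e] at hyA)))
      · refine absurd hyA (hl _ ?_)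
        have : y.val + 2 = p + 1 := e
        omega

end graph

theorem proposition9 (n : ℕ) (hn : 2 ≤ n) (γ : ℂ) (him : γ.im ≠ 0) (hγ : ‖γ‖ ≠ 1)
    (hM : (farMetric n γ).PosDef) (A : Finset (Fin n)) :
    (∃ O : FockOp n, IsQuasiHermitian (totalMetric (farMetric n γ)) O ∧
      IsBKExtensivelyLocal A O) ↔ ConnectivityConditions A := by
  have hgen : IsGenericPair γ (starRingEnd ℂ γ) :=
    isGenericPair_star (fun h => him (by simp [h])) hγ
  rw [exists_quasiHermitian_extensivelyLocal_iff hM]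
  simp only [exists_mem_biSupported_iff him]
  constructor
  · intro h
    refine SiteConditions.connectivityConditions hn
      (siteConditions_of_exists_seen hgen (fun i hi => hi.1) ?_)
    rintro k ⟨hkn, hk⟩
    exact h ⟨k, hkn⟩ hk
  · exact fun h k hk => (h.siteConditions hn).exists_seen hgen hn (mem_iff_sitePred.mp hk)
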